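/- Let $\tau \ge 1$ and $\alpha \in (1/2,1)$ be real numbers and let $f(n) = \lfloor n^\tau \rfloor$ for $n = 1, 2, \ldots$ (a Piatetski-Shapiro sequence). For $x \in [0,1]$ and $N \in \mathbb{N}$ put $$V_f(x;N) = \sum_{n=1}^{N} \exp\bigl(2\pi i\, x f(n)\bigr),$$ and let $$\mathcal{F}_{f,\alpha} = \bigl\{x \in [0,1] : |V_f(x;N)| \ge N^{\alpha} \text{ for infinitely many } N \in \mathbb{N}\bigr\}.$$ Then the Hausdorff dimension of $\mathcal{F}_{f,\alpha}$ satisfies $$\dim \mathcal{F}_{f,\alpha} \le \begin{cases} 1 - \dfrac{4\alpha+\tau-4}{\tau+1-\alpha} & \text{if } \tau < 2,\\[2ex] 1 - \dfrac{4\alpha-2}{\tau+1-\alpha} & \text{if } \tau \ge 2. \end{cases}$$ -/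

import Mathlib

/-- The exponential sum `V_f(x; N) = ∑_{n=1}^N e(x f(n))`, where `e(z) = exp(2πiz)`,
of a real sequence `f`. -/
noncomputable def expSum (f : ℕ → ℝ) (x : ℝ) (N : ℕ) : ℂ :=
  ∑ n ∈ Finset.Icc 1 N, Complex.exp (2 * Real.pi * Complex.I * ((x * f n : ℝ) : ℂ))

/-- The set `F_{f,α}` of those `x ∈ [0,1]` with `|V_f(x; N)| ≥ N ^ α` for infinitely many `N`. -/
def largeSumSet (f : ℕ → ℝ) (α : ℝ) : Set ℝ :=
  {x | x ∈ Set.Icc (0 : ℝ) 1 ∧ {N : ℕ | (N : ℝ) ^ α ≤ ‖expSum f x N‖}.Infinite}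

/-- The Piatetski-Shapiro sequence `n ↦ ⌊n ^ τ⌋`. -/
noncomputable def piatetskiShapiro (τ : ℝ) (n : ℕ) : ℝ :=
  ((⌊(n : ℝ) ^ τ⌋ : ℤ) : ℝ)

/-! The dimension bound comes from a fourth moment. Put e = max(2, 4 - τ). The integral over [0,1]
of the fourth power of the sum of e(x⌊n^τ⌋) over a dyadic block counts solutions of ⌊a^τ⌋ + ⌊b^τ⌋ =
⌊c^τ⌋ + ⌊d^τ⌋, and this additive energy is O(N^(e+ε)) for blocks of length N
(`exists_seqEnergy_floorPow_le`). A Rademacher–Menshov argument turns it into one majorant U_k that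
controls all N ≤ 2^k simultaneously. Put D = τ + 1 - α and cut [0,1] into about 2^(kD) cells. The
sum moves by at most N^α/2 inside a cell, so one large value forces U_k to be large on the whole
cell, and Markov's inequality bounds the number of such cells. Their total s-cost converges when D(1
- s) + e - 4α < 0, that is s > 1 - (4α - e)/D.

The arithmetic core is the count of integer quadruples of size M with |x₀^τ + x₁^τ - x₂^τ - x₃^τ| ≤
A r² M^τ. After division by x₃ they lie near a surface, which is cut into about r⁻² caps of width r.
A cap lies in a convex body, and a Fourier transference inequality (`card_mul_volume_le`) bounds its
integer points by r⁴M⁴ times the number of integer points in a dual box. The zero vector contributes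
r²M⁴ in total. A nonzero dual point is a near solution for the conjugate exponent τ/(τ - 1), of size
L up to a multiple of K = 1/(r²M), at the critical precision 1/L (`exists_dual_bound`), and it
serves only O((K/L)²) caps. So a bound L^(2+ξ) for the conjugate exponent gives r²M⁴ + r⁴M⁴K^(2+ξ)
for τ (`exists_card_nearSolution_le`).

Optimising r replaces ξ by ξ/(1 + ξ) at the critical precision r = 1/M. Conjugation preserves τ > 1,
so the step can be iterated from the trivial bound M⁴ and makes ξ arbitrarily small
(`nearSolutionBound_of_pos`). -/

open MeasureTheory Set

/-! ### Additive characters -/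

/-- The additive character `z ↦ exp (2πiz)` of the real line. -/
noncomputable def unitChar (z : ℝ) : ℂ := Complex.exp (2 * Real.pi * Complex.I * (z : ℂ))

lemma unitChar_zero : unitChar 0 = 1 := by simp [unitChar]

lemma unitChar_add (a b : ℝ) : unitChar (a + b) = unitChar a * unitChar b := by
  simp [unitChar, ← Complex.exp_add, mul_add]

lemma norm_unitChar (a : ℝ) : ‖unitChar a‖ = 1 := by
  have h : 2 * (Real.pi : ℂ) * Complex.I * (a : ℂ) = ((2 * Real.pi * a : ℝ) : ℂ) * Complex.I := by
    push_cast; ring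
  rw [unitChar, h, Complex.norm_exp_ofReal_mul_I]

lemma conj_unitChar (a : ℝ) : (starRingEnd ℂ) (unitChar a) = unitChar (-a) := by
  rw [unitChar, unitChar, ← Complex.exp_conj]
  simp [map_ofNat]

lemma unitChar_intCast (n : ℤ) : unitChar n = 1 := by
  rw [unitChar, Complex.exp_eq_one_iff]
  exact ⟨n, by push_cast; ring⟩

@[fun_prop]
lemma continuous_unitChar : Continuous unitChar := by
  unfold unitChar; fun_prop

lemma re_unitChar (a : ℝ) : (unitChar a).re = Real.cos (2 * Real.pi * a) := by
  have h : 2 * (Real.pi : ℂ) * Complex.I * (a : ℂ) = ((2 * Real.pi * a : ℝ) : ℂ) * Complex.I := by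
    push_cast; ring
  rw [unitChar, h, Complex.exp_ofReal_mul_I_re]

lemma half_le_re_unitChar {a : ℝ} (ha : |a| ≤ 1 / 6) : 1 / 2 ≤ (unitChar a).re := by
  rw [re_unitChar, ← Real.cos_pi_div_three, ← Real.cos_abs (2 * Real.pi * a)]
  have hp := Real.pi_pos
  have h : |2 * Real.pi * a| = 2 * Real.pi * |a| := by
    rw [abs_mul, abs_of_pos (by positivity)]
  apply Real.cos_le_cos_of_nonneg_of_le_pi (abs_nonneg _) (by linarith)
  rw [h]; nlinarith

lemma unitChar_sum {ι : Type*} (s : Finset ι) (f : ι → ℝ) :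
    unitChar (∑ i ∈ s, f i) = ∏ i ∈ s, unitChar (f i) := by
  classical
  induction s using Finset.induction_on with
  | empty => simp [unitChar_zero]
  | insert a s ha ih => rw [Finset.sum_insert ha, Finset.prod_insert ha, unitChar_add, ih]

lemma integral_unitChar (n : ℤ) :
    ∫ x in (0 : ℝ)..1, unitChar (n * x) = if n = 0 then 1 else 0 := by
  split_ifs with h
  · simp [h, unitChar_zero]
  · have hc : 2 * Real.pi * Complex.I * (n : ℂ) ≠ 0 := by
      have : (n : ℂ) ≠ 0 := by exact_mod_cast h
      simp [Real.pi_ne_zero, this]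
    have h1 : ∀ x : ℝ, unitChar (n * x) = Complex.exp (2 * Real.pi * Complex.I * (n : ℂ) * x) := by
      intro x; simp only [unitChar]; push_cast; ring_nf
    simp_rw [h1]
    rw [integral_exp_mul_complex hc]
    have h2 := unitChar_intCast n
    rw [unitChar] at h2
    have h3 : Complex.exp (2 * Real.pi * Complex.I * (n : ℂ)) = 1 := by simpa using h2
    simp [h3]

/-! ### Transference: integer points in a body versus its dual -/

section Transference

variable {ι : Type*} [Fintype ι]

/-- The exponential polynomial with frequencies in `X`. -/
noncomputable def freqSum (X : Finset (ι → ℤ)) (w : ι → ℝ) : ℂ :=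
  ∑ x ∈ X, unitChar (∑ i, (x i : ℝ) * w i)

lemma continuous_freqSum (X : Finset (ι → ℤ)) : Continuous (freqSum X) := by
  unfold freqSum; fun_prop

lemma freqSum_add_int (X : Finset (ι → ℤ)) (w : ι → ℝ) (k : ι → ℤ) :
    freqSum X (w + fun i => (k i : ℝ)) = freqSum X w := by
  refine Finset.sum_congr rfl fun x _ => ?_
  have : ∑ i, (x i : ℝ) * ((w + fun i => (k i : ℝ)) i) =
      (∑ i, (x i : ℝ) * w i) + ((∑ i, x i * k i : ℤ) : ℝ) := by
    push_cast
    rw [← Finset.sum_add_distrib]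
    exact Finset.sum_congr rfl fun i _ => by simp [mul_add]
  rw [this, unitChar_add, unitChar_intCast, mul_one]

lemma integral_unitCube_unitChar (x : ι → ℤ) :
    ∫ w in (univ.pi fun _ : ι => Ioc (0 : ℝ) 1), unitChar (∑ i, (x i : ℝ) * w i) =
      if x = 0 then 1 else 0 := by
  simp_rw [unitChar_sum]
  rw [volume_pi, Measure.restrict_pi_pi,
    integral_fintype_prod_eq_prod (fun i (t : ℝ) => unitChar ((x i : ℝ) * t))]
  simp_rw [← intervalIntegral.integral_of_le (zero_le_one (α := ℝ)), integral_unitChar]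
  split_ifs with h
  · simp [h]
  · obtain ⟨i, hi⟩ := Function.ne_iff.mp h
    exact Finset.prod_eq_zero (Finset.mem_univ i) (by simpa using hi)

lemma integrableOn_unitCube {E : Type*} [NormedAddCommGroup E] {f : (ι → ℝ) → E}
    (hf : Continuous f) : IntegrableOn f (univ.pi fun _ : ι => Ioc (0 : ℝ) 1) := by
  have : IntegrableOn f (univ.pi fun _ : ι => Icc (0 : ℝ) 1) :=
    hf.continuousOn.integrableOn_compact (isCompact_univ_pi fun _ => isCompact_Icc)
  exact this.mono_set (pi_mono fun _ _ => Ioc_subset_Icc_self)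

/-- Parseval: after expanding the square, orthogonality of characters leaves only the diagonal
pairs. -/
lemma integral_unitCube_normSq_freqSum (X : Finset (ι → ℤ)) :
    ∫ w in (univ.pi fun _ : ι => Ioc (0 : ℝ) 1), ‖freqSum X w‖ ^ 2 = X.card := by
  classical
  have h1 : ∀ w, ((‖freqSum X w‖ ^ 2 : ℝ) : ℂ) =
      ∑ x ∈ X, ∑ y ∈ X, unitChar (∑ i, ((x - y) i : ℝ) * w i) := by
    intro w
    have : ((‖freqSum X w‖ ^ 2 : ℝ) : ℂ) = freqSum X w * (starRingEnd ℂ) (freqSum X w) := by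
      rw [Complex.mul_conj, Complex.normSq_eq_norm_sq]
    rw [this, freqSum, map_sum, Finset.sum_mul_sum]
    refine Finset.sum_congr rfl fun x _ => Finset.sum_congr rfl fun y _ => ?_
    rw [conj_unitChar, ← unitChar_add]
    congr 1
    rw [← sub_eq_add_neg, ← Finset.sum_sub_distrib]
    exact Finset.sum_congr rfl fun i _ => by simp [sub_mul]
  have h2 : (∫ w in (univ.pi fun _ : ι => Ioc (0 : ℝ) 1), ((‖freqSum X w‖ ^ 2 : ℝ) : ℂ)) =
      (X.card : ℂ) := by
    simp_rw [h1]
    have hint : ∀ x y : ι → ℤ, IntegrableOn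
        (fun w : ι → ℝ => unitChar (∑ i, (((x - y) i : ℤ) : ℝ) * w i))
        (univ.pi fun _ : ι => Ioc (0 : ℝ) 1) := fun x y =>
      integrableOn_unitCube (by fun_prop)
    rw [integral_finsetSum _ fun x _ => integrable_finsetSum _ fun y _ => hint x y]
    simp_rw [integral_finsetSum X fun y _ => hint _ y, integral_unitCube_unitChar, sub_eq_zero]
    simp
  rw [integral_complex_ofReal] at h2
  exact_mod_cast h2

/-- Half-open integer translates of the unit cube tile space exactly, so integrating over the whole
space amounts to summing over the lattice and integrating over the torus. -/
lemma lintegral_fold (h : (ι → ℝ) → ENNReal) (hm : Measurable h) :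
    ∫⁻ w, h w = ∫⁻ w in (univ.pi fun _ : ι => Ioc (0 : ℝ) 1),
      ∑' k : ι → ℤ, h (w + fun i => (k i : ℝ)) := by
  set Q : Set (ι → ℝ) := univ.pi fun _ => Ioc (0 : ℝ) 1 with hQ
  have hQm : MeasurableSet Q := MeasurableSet.univ_pi fun _ => measurableSet_Ioc
  let T : (ι → ℤ) → Set (ι → ℝ) := fun k => univ.pi fun i => Ioc (k i : ℝ) (k i + 1)
  have hTm : ∀ k, MeasurableSet (T k) := fun k => MeasurableSet.univ_pi fun _ => measurableSet_Ioc
  have hU : ⋃ k, T k = univ := by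
    refine eq_univ_of_forall fun w => mem_iUnion.2 ⟨fun i => ⌈w i⌉ - 1, fun i _ => ⟨?_, ?_⟩⟩
    · have := Int.ceil_lt_add_one (w i); push_cast; linarith
    · have := Int.le_ceil (w i); push_cast; linarith
  have hd : Pairwise (Function.onFun Disjoint T) := by
    intro k l hkl
    refine disjoint_left.2 fun w hk hl => hkl (funext fun i => ?_)
    have h1 := hk i (mem_univ i)
    have h2 := hl i (mem_univ i)
    have h3 : (k i : ℝ) < l i + 1 := h1.1.trans_le h2.2
    have h4 : (l i : ℝ) < k i + 1 := h2.1.trans_le h1.2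
    have h5 : k i < l i + 1 := by exact_mod_cast h3
    have h6 : l i < k i + 1 := by exact_mod_cast h4
    omega
  rw [← setLIntegral_univ, ← hU, lintegral_iUnion hTm hd, lintegral_tsum]
  · refine tsum_congr fun k => ?_
    rw [← lintegral_indicator (hTm k), ← lintegral_indicator hQm,
      ← lintegral_add_right_eq_self _ (fun i => (k i : ℝ))]
    refine lintegral_congr fun w => ?_
    have : w + (fun i => (k i : ℝ)) ∈ T k ↔ w ∈ Q := by
      simp only [T, hQ, mem_pi, mem_univ, true_implies, Pi.add_apply, mem_Ioc]
      exact forall_congr' fun i => by constructor <;> rintro ⟨a, b⟩ <;> constructor <;> linarith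
    by_cases hw : w ∈ Q
    · rw [indicator_of_mem (this.2 hw), indicator_of_mem hw]
    · rw [indicator_of_notMem (fun h => hw (this.1 h)), indicator_of_notMem hw]
  · exact fun k => (hm.comp (measurable_id.add_const _)).aemeasurable

/-- If `ω · x` is within `1/6` of zero for all `x ∈ X` and `ω ∈ D`, then `|X| vol(D)` is at most
four times the number of integer points in the difference set `D - D`. -/
theorem card_mul_volume_le (X Z : Finset (ι → ℤ)) (D : Set (ι → ℝ)) (hD : MeasurableSet D)
    (hX : ∀ x ∈ X, ∀ w ∈ D, |∑ i, (x i : ℝ) * w i| ≤ 1 / 6)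
    (hZ : ∀ k : ι → ℤ, ∀ w ∈ D, (w + fun i => (k i : ℝ)) ∈ D → k ∈ Z) :
    (X.card : ENNReal) * volume D ≤ 4 * Z.card := by
  classical
  rcases X.eq_empty_or_nonempty with hX0 | hX0
  · simp [hX0]
  set Q : Set (ι → ℝ) := univ.pi fun _ => Ioc (0 : ℝ) 1 with hQ
  let g : (ι → ℝ) → ENNReal := fun w => ENNReal.ofReal (‖freqSum X w‖ ^ 2)
  have hgm : Measurable g := by
    have := continuous_freqSum X
    exact ENNReal.measurable_ofReal.comp (by fun_prop)
  have hlow : ∀ w ∈ D, ENNReal.ofReal ((X.card : ℝ) ^ 2 / 4) ≤ g w := by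
    intro w hw
    refine ENNReal.ofReal_le_ofReal ?_
    have h1 : (X.card : ℝ) * (1 / 2) ≤ (freqSum X w).re := by
      rw [freqSum, Complex.re_sum, ← nsmul_eq_mul]
      exact Finset.card_nsmul_le_sum _ _ _ fun x hx => half_le_re_unitChar (hX x hx w hw)
    have h2 := (le_abs_self _).trans (Complex.abs_re_le_norm (freqSum X w))
    have h3 : (0 : ℝ) ≤ X.card := by positivity
    nlinarith
  have h1 : ENNReal.ofReal ((X.card : ℝ) ^ 2 / 4) * volume D ≤ ∫⁻ w, D.indicator g w := by
    rw [lintegral_indicator hD, ← setLIntegral_const]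
    exact setLIntegral_mono hgm hlow
  -- By periodicity every shift of `w` that lands in `D` contributes the same value. Two such shifts
  -- differ by an element of `Z`, so there are at most `Z.card` of them.
  have hmult : ∀ w, ∑' k : ι → ℤ, D.indicator g (w + fun i => (k i : ℝ)) ≤ Z.card * g w := by
    intro w
    by_cases hne : ∃ k0 : ι → ℤ, (w + fun i => (k0 i : ℝ)) ∈ D
    · obtain ⟨k0, hk0⟩ := hne
      have hsub : ∀ k : ι → ℤ, k ∉ Z.image (fun z => z + k0) →
          D.indicator g (w + fun i => (k i : ℝ)) = 0 := by
        intro k hk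
        refine indicator_of_notMem (fun hkD => hk ?_) _
        refine Finset.mem_image.2 ⟨k - k0, hZ (k - k0) _ hk0 ?_, by abel⟩
        convert hkD using 1
        ext i; simp
      rw [tsum_eq_sum (s := Z.image fun z => z + k0) fun k hk => hsub k hk]
      calc _ ≤ ∑ k ∈ Z.image (fun z => z + k0), g w := by
            refine Finset.sum_le_sum fun k _ => ?_
            refine (indicator_le_self _ _ _).trans (le_of_eq ?_)
            simp only [g, freqSum_add_int]
        _ ≤ _ := by
            rw [Finset.sum_const, nsmul_eq_mul]
            exact mul_le_mul' (Nat.cast_le.2 Finset.card_image_le) le_rfl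
    · push Not at hne
      have : ∀ k : ι → ℤ, D.indicator g (w + fun i => (k i : ℝ)) = 0 := fun k =>
        indicator_of_notMem (hne k) _
      simp [this]
  have h2 : ∫⁻ w, D.indicator g w ≤ Z.card * X.card := by
    rw [lintegral_fold _ (hgm.indicator hD)]
    refine (lintegral_mono hmult).trans ?_
    rw [lintegral_const_mul _ hgm]
    gcongr
    have hc := continuous_freqSum X
    rw [← ofReal_integral_eq_lintegral_ofReal
      (integrableOn_unitCube (by fun_prop)) (Filter.Eventually.of_forall fun w => by positivity),
      integral_unitCube_normSq_freqSum]
    simp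
  have h3 := h1.trans h2
  have hc0 : (X.card : ENNReal) ≠ 0 := by simpa using hX0.ne_empty
  have hc1 : (X.card : ENNReal) ≠ ⊤ := ENNReal.natCast_ne_top _
  have h4 : ENNReal.ofReal ((X.card : ℝ) ^ 2 / 4) * 4 = (X.card : ENNReal) * X.card := by
    rw [show (4 : ENNReal) = ENNReal.ofReal 4 by simp, ← ENNReal.ofReal_mul (by positivity),
      show (X.card : ℝ) ^ 2 / 4 * 4 = X.card * X.card by ring,
      ENNReal.ofReal_mul (by positivity), ENNReal.ofReal_natCast]
  have h5 : (X.card : ENNReal) * (X.card * volume D) ≤ X.card * (4 * Z.card) := by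
    calc (X.card : ENNReal) * (X.card * volume D)
        = 4 * (ENNReal.ofReal ((X.card : ℝ) ^ 2 / 4) * volume D) := by
          rw [← mul_assoc, ← h4]; ring
      _ ≤ 4 * (Z.card * X.card) := by gcongr
      _ = _ := by ring
  exact (ENNReal.mul_le_mul_iff_right hc0 hc1).1 h5

end Transference

/-! ### Uniform Lipschitz and Taylor bounds for powers -/

section PowerEstimates

lemma rpow_mem_Icc_inv {lam q x : ℝ} (hlam : 1 ≤ lam) (hq : 0 ≤ q) (hx : x ∈ Icc lam⁻¹ lam) :
    x ^ q ∈ Icc (lam ^ q)⁻¹ (lam ^ q) := by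
  have h0 : 0 < lam := by linarith
  have hx0 : 0 < x := (inv_pos.2 h0).trans_le hx.1
  refine ⟨?_, Real.rpow_le_rpow hx0.le hx.2 hq⟩
  rw [← Real.inv_rpow h0.le]
  exact Real.rpow_le_rpow (inv_pos.2 h0).le hx.1 hq

lemma exists_abs_rpow_le (q lam : ℝ) (hlam : 1 ≤ lam) :
    ∃ C, 0 ≤ C ∧ ∀ x ∈ Icc lam⁻¹ lam, |x ^ q| ≤ C := by
  have h0 : 0 < lam := by linarith
  obtain ⟨C, hC⟩ := (isCompact_Icc (a := lam⁻¹) (b := lam)).exists_bound_of_continuousOn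
    (f := fun x : ℝ => x ^ q)
    (continuousOn_id.rpow_const fun x hx => Or.inl ((inv_pos.2 h0).trans_le hx.1).ne')
  exact ⟨max C 0, le_max_right _ _, fun x hx => (hC x hx).trans (le_max_left _ _)⟩

lemma exists_rpow_lipschitz (q lam : ℝ) (hlam : 1 ≤ lam) :
    ∃ C, 0 ≤ C ∧ ∀ x ∈ Icc lam⁻¹ lam, ∀ y ∈ Icc lam⁻¹ lam, |x ^ q - y ^ q| ≤ C * |x - y| := by
  have h0 : 0 < lam := by linarith
  obtain ⟨C, hC0, hC⟩ := exists_abs_rpow_le (q - 1) lam hlam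
  refine ⟨|q| * C, by positivity, fun x hx y hy => ?_⟩
  refine Convex.norm_image_sub_le_of_norm_hasDerivWithin_le (f := fun x : ℝ => x ^ q)
    (f' := fun x => q * x ^ (q - 1)) (s := Icc lam⁻¹ lam) ?_ ?_ (convex_Icc _ _) hy hx
  · intro z hz
    exact (Real.hasDerivAt_rpow_const
      (Or.inl ((inv_pos.2 h0).trans_le hz.1).ne')).hasDerivWithinAt
  · intro z hz
    rw [Real.norm_eq_abs, abs_mul]
    exact mul_le_mul_of_nonneg_left (hC z hz) (abs_nonneg _)

lemma exists_rpow_taylor (q lam : ℝ) (hlam : 1 ≤ lam) :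
    ∃ C, 0 ≤ C ∧ ∀ x ∈ Icc lam⁻¹ lam, ∀ y ∈ Icc lam⁻¹ lam,
      |x ^ q - y ^ q - q * y ^ (q - 1) * (x - y)| ≤ C * (x - y) ^ 2 := by
  have h0 : 0 < lam := by linarith
  obtain ⟨C, hC0, hC⟩ := exists_rpow_lipschitz (q - 1) lam hlam
  refine ⟨|q| * C, by positivity, fun x hx y hy => ?_⟩
  have hsub : uIcc y x ⊆ Icc lam⁻¹ lam := uIcc_subset_Icc hy hx
  have key := Convex.norm_image_sub_le_of_norm_hasDerivWithin_le
    (f := fun z : ℝ => z ^ q - q * y ^ (q - 1) * z)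
    (f' := fun z => q * z ^ (q - 1) - q * y ^ (q - 1)) (s := uIcc y x)
    (C := |q| * C * |x - y|) (x := y) (y := x) ?_ ?_ (convex_uIcc _ _) left_mem_uIcc right_mem_uIcc
  · have e : (x ^ q - q * y ^ (q - 1) * x) - (y ^ q - q * y ^ (q - 1) * y) =
        x ^ q - y ^ q - q * y ^ (q - 1) * (x - y) := by ring
    rw [Real.norm_eq_abs, e, Real.norm_eq_abs, mul_assoc (|q| * C), ← pow_two, sq_abs] at key
    exact key
  · intro z hz
    have h1 : HasDerivAt (fun z : ℝ => z ^ q) (q * z ^ (q - 1)) z :=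
      Real.hasDerivAt_rpow_const (Or.inl ((inv_pos.2 h0).trans_le (hsub hz).1).ne')
    have h2 : HasDerivAt (fun z : ℝ => q * y ^ (q - 1) * z) (q * y ^ (q - 1)) z := by
      simpa using (hasDerivAt_id z).const_mul (q * y ^ (q - 1))
    exact (h1.sub h2).hasDerivWithinAt
  · intro z hz
    rw [← mul_sub, Real.norm_eq_abs, abs_mul, mul_assoc]
    refine mul_le_mul_of_nonneg_left ((hC z (hsub hz) y hy).trans ?_) (abs_nonneg _)
    refine mul_le_mul_of_nonneg_left ?_ hC0
    exact abs_sub_left_of_mem_uIcc hz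

end PowerEstimates

/-! ### Geometry of the surface and of its dual -/

/-- Near a point `α` of the surface `y₀ ^ τ + y₁ ^ τ - y₂ ^ τ = 1`, points of the surface lie
close to the tangent plane at `α`. -/
lemma exists_tangent_bound (τ lam A : ℝ) (hτ : 1 < τ) (hlam : 1 ≤ lam) (hA : 0 ≤ A) :
    ∃ C, 0 ≤ C ∧ ∀ r, 0 < r → r ≤ 1 → ∀ y0 ∈ Icc lam⁻¹ lam, ∀ y1 ∈ Icc lam⁻¹ lam,
      ∀ y2 ∈ Icc lam⁻¹ lam, ∀ a0 ∈ Icc lam⁻¹ lam, ∀ a1 ∈ Icc lam⁻¹ lam, ∀ a2 ∈ Icc lam⁻¹ lam,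
      |y0 - a0| ≤ r → |y1 - a1| ≤ r →
      |y0 ^ τ + y1 ^ τ - y2 ^ τ - 1| ≤ A * r ^ 2 → |a0 ^ τ + a1 ^ τ - a2 ^ τ - 1| ≤ A * r ^ 2 →
      |a0 ^ (τ - 1) * y0 + a1 ^ (τ - 1) * y1 - a2 ^ (τ - 1) * y2 - 1| ≤ C * r ^ 2 := by
  have hlam0 : 0 < lam := by linarith
  have hτ0 : 0 < τ := by linarith
  obtain ⟨L, hL0, hL⟩ := exists_rpow_lipschitz τ lam hlam
  obtain ⟨L', hL'0, hL'⟩ := exists_rpow_lipschitz τ⁻¹ (lam ^ τ) (Real.one_le_rpow hlam hτ0.le)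
  obtain ⟨T, hT0, hT⟩ := exists_rpow_taylor τ lam hlam
  set B := L' * (2 * A + 2 * L) with hB
  have hB0 : 0 ≤ B := by positivity
  refine ⟨2 * A + (2 * T + T * B ^ 2) + τ * A, by positivity, ?_⟩
  intro r hr hr1 y0 hy0 y1 hy1 y2 hy2 a0 ha0 a1 ha1 a2 ha2 h0 h1 hy ha
  have hpos : ∀ {x : ℝ}, x ∈ Icc lam⁻¹ lam → 0 < x := fun hx => (inv_pos.2 hlam0).trans_le hx.1
  have hrr : r ^ 2 ≤ r := by nlinarith
  have e0 := hL y0 hy0 a0 ha0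
  have e1 := hL y1 hy1 a1 ha1
  have e0' : |y0 ^ τ - a0 ^ τ| ≤ L * r := e0.trans (mul_le_mul_of_nonneg_left h0 hL0)
  have e1' : |y1 ^ τ - a1 ^ τ| ≤ L * r := e1.trans (mul_le_mul_of_nonneg_left h1 hL0)
  have hAr : A * r ^ 2 ≤ A * r := mul_le_mul_of_nonneg_left hrr hA
  have e2 : |y2 ^ τ - a2 ^ τ| ≤ (2 * A + 2 * L) * r := by
    rw [abs_le] at *
    constructor <;> linarith [e0'.1, e0'.2, e1'.1, e1'.2, hy.1, hy.2, ha.1, ha.2]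
  -- Closeness of the third coordinate is not assumed: the equation makes the `τ`-th powers close,
  -- and the inverse power is Lipschitz.
  have h2 : |y2 - a2| ≤ B * r := by
    have := hL' _ (rpow_mem_Icc_inv hlam hτ0.le hy2) _ (rpow_mem_Icc_inv hlam hτ0.le ha2)
    rw [Real.rpow_rpow_inv (hpos hy2).le hτ0.ne', Real.rpow_rpow_inv (hpos ha2).le hτ0.ne'] at this
    refine this.trans ?_
    rw [hB, mul_assoc]
    exact mul_le_mul_of_nonneg_left e2 hL'0
  have sq_le : ∀ {u v : ℝ}, |u| ≤ v → u ^ 2 ≤ v ^ 2 := fun {u v} h => by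
    rw [← sq_abs u]; exact pow_le_pow_left₀ (abs_nonneg _) h 2
  have t0 := (hT y0 hy0 a0 ha0).trans (mul_le_mul_of_nonneg_left (sq_le h0) hT0)
  have t1 := (hT y1 hy1 a1 ha1).trans (mul_le_mul_of_nonneg_left (sq_le h1) hT0)
  have t2 := (hT y2 hy2 a2 ha2).trans (mul_le_mul_of_nonneg_left (sq_le h2) hT0)
  have p : ∀ {x : ℝ}, x ∈ Icc lam⁻¹ lam → x ^ τ = x ^ (τ - 1) * x := fun {x} hx => by
    rw [Real.rpow_sub_one (hpos hx).ne', div_mul_cancel₀ _ (hpos hx).ne']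
  set X := a0 ^ (τ - 1) * y0 + a1 ^ (τ - 1) * y1 - a2 ^ (τ - 1) * y2 - 1 with hX
  -- By homogeneity (Euler's relation) the affine form of the tangent plane is, up to the factor
  -- `τ`, the two defects from the surface combined with three Taylor remainders.
  have e : τ * X = ((y0 ^ τ + y1 ^ τ - y2 ^ τ - 1) - (a0 ^ τ + a1 ^ τ - a2 ^ τ - 1))
      - (y0 ^ τ - a0 ^ τ - τ * a0 ^ (τ - 1) * (y0 - a0))
      - (y1 ^ τ - a1 ^ τ - τ * a1 ^ (τ - 1) * (y1 - a1))
      + (y2 ^ τ - a2 ^ τ - τ * a2 ^ (τ - 1) * (y2 - a2))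
      + τ * (a0 ^ τ + a1 ^ τ - a2 ^ τ - 1) := by
    rw [p ha0, p ha1, p ha2, hX]; ring
  have hfin : |τ * X| ≤ (2 * A + (2 * T + T * B ^ 2) + τ * A) * r ^ 2 := by
    have h5 : |τ * (a0 ^ τ + a1 ^ τ - a2 ^ τ - 1)| ≤ τ * (A * r ^ 2) := by
      rw [abs_mul, abs_of_pos hτ0]; exact mul_le_mul_of_nonneg_left ha hτ0.le
    rw [e]
    rw [abs_le] at *
    rw [mul_pow] at t2
    constructor <;>
      linarith [hy.1, hy.2, ha.1, ha.2, t0.1, t0.2, t1.1, t1.2, t2.1, t2.2, h5.1, h5.2]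
  have h6 : |X| ≤ |τ * X| := by
    rw [abs_mul, abs_of_pos hτ0]
    nlinarith [abs_nonneg X]
  exact h6.trans hfin

set_option maxHeartbeats 1000000 in
/-- A nonzero integer point `l` in the dual box of a cap of the surface
`y₀ ^ τ + y₁ ^ τ - y₂ ^ τ = 1` lies near the dual surface, and determines the cap approximately. -/
lemma exists_dual_bound (τ lam A : ℝ) (hτ : 1 < τ) (hlam : 1 ≤ lam) (hA : 0 ≤ A) :
    ∃ c0 μ C, 0 < c0 ∧ c0 ≤ 1 ∧ 1 ≤ μ ∧ 0 ≤ C ∧ ∀ c, 0 < c → c ≤ c0 → ∀ M r, 1 ≤ M → 1 ≤ r * M →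
      r ≤ 1 → ∀ a0 ∈ Icc lam⁻¹ lam, ∀ a1 ∈ Icc lam⁻¹ lam, ∀ a2 ∈ Icc lam⁻¹ lam,
      |a0 ^ τ + a1 ^ τ - a2 ^ τ - 1| ≤ A * r ^ 2 →
      ∀ s t1 t2 w : ℝ, 0 ≤ s → s ≤ c / (r ^ 2 * M) → |t1| ≤ c / (r * M) → |t2| ≤ c / (r * M) →
      |w| ≤ c / M → ∀ l0 l1 l2 l3 : ℤ, (l0 : ℝ) = s * a0 ^ (τ - 1) + t1 →
      (l1 : ℝ) = s * a1 ^ (τ - 1) + t2 → (l2 : ℝ) = s * a2 ^ (τ - 1) →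
      (l3 : ℝ) = s + a0 * t1 + a1 * t2 - w → ¬ (l0 = 0 ∧ l1 = 0 ∧ l2 = 0 ∧ l3 = 0) →
      μ⁻¹ ≤ s ∧ (l0 : ℝ) ∈ Icc (s / μ) (μ * s) ∧ (l1 : ℝ) ∈ Icc (s / μ) (μ * s) ∧
      (l2 : ℝ) ∈ Icc (s / μ) (μ * s) ∧ (l3 : ℝ) ∈ Icc (s / μ) (μ * s) ∧
      |(l0 : ℝ) ^ (τ / (τ - 1)) + (l1 : ℝ) ^ (τ / (τ - 1)) - (l2 : ℝ) ^ (τ / (τ - 1))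
        - (l3 : ℝ) ^ (τ / (τ - 1))| ≤ C * s ^ (τ / (τ - 1) - 2) ∧
      |a0 - ((l0 : ℝ) / l3) ^ (τ - 1)⁻¹| ≤ C / (r * M * s) ∧
      |a1 - ((l1 : ℝ) / l3) ^ (τ - 1)⁻¹| ≤ C / (r * M * s) := by
  have hlam0 : 0 < lam := by linarith
  have hτ0 : 0 < τ - 1 := by linarith
  set Λ := lam ^ (τ - 1) with hΛ
  have hΛ1 : 1 ≤ Λ := Real.one_le_rpow hlam hτ0.le
  set β := τ / (τ - 1) with hβ
  have hβ1 : β - 1 = (τ - 1)⁻¹ := by rw [hβ]; field_simp; ring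
  have hβ0 : 0 < β := by positivity
  set μ := 2 * Λ with hμ
  have hμ1 : 1 ≤ μ := by linarith
  have hμ0 : 0 < μ := by linarith
  set G := 2 * lam + 1 with hG
  have hG1 : 1 ≤ G := by linarith
  obtain ⟨T, hT0, hT⟩ := exists_rpow_taylor β μ hμ1
  obtain ⟨L, hL0, hL⟩ := exists_rpow_lipschitz (τ - 1)⁻¹ (μ ^ 2) (one_le_pow₀ hμ1)
  set C := (A + β + 3 * T * G ^ 2) + L * (μ * ((1 + Λ) * G)) with hC
  -- `G` bounds the combined weight of `t1`, `t2`, `w` in the last coordinate. This `c0` keeps every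
  -- perturbation of `s` times the normal below `1/4`, which forces `s` to be bounded below, and
  -- then below `s / (2 * Λ)`, which keeps all coordinates comparable to `s`.
  refine ⟨1 / (4 * Λ ^ 2 * G), μ, C, by positivity, ?_, hμ1, by positivity, ?_⟩
  · rw [div_le_one (by positivity)]
    have := one_le_mul_of_one_le_of_one_le (one_le_pow₀ hΛ1 (n := 2)) hG1
    linarith
  intro c hc hc0 M r hM hrM hr1 a0 ha0 a1 ha1 a2 ha2 ha s t1 t2 w hs hsK ht1 ht2 hw
    l0 l1 l2 l3 hl0 hl1 hl2 hl3 hne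
  have hM0 : 0 < M := by linarith
  have hr0 : 0 < r := by
    by_contra h; push Not at h
    linarith [mul_nonpos_of_nonpos_of_nonneg h hM0.le]
  have hc1 : c * G ≤ 1 / (4 * Λ ^ 2) := by
    have := mul_le_mul_of_nonneg_right hc0 (by linarith : 0 ≤ G)
    refine this.trans (le_of_eq ?_)
    field_simp
  have hpos : ∀ {x : ℝ}, x ∈ Icc lam⁻¹ lam → 0 < x := fun hx => (inv_pos.2 hlam0).trans_le hx.1
  have hb : ∀ {x : ℝ}, x ∈ Icc lam⁻¹ lam → x ^ (τ - 1) ∈ Icc Λ⁻¹ Λ := fun hx =>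
    rpow_mem_Icc_inv hlam hτ0.le hx
  set D := 1 / (r * M) with hD
  have hD0 : 0 < D := by positivity
  have hD1 : D ≤ 1 := by rw [hD, div_le_one (by positivity)]; exact hrM
  have hcD : c / (r * M) = c * D := by rw [hD]; ring
  rw [hcD] at ht1 ht2
  have hw' : |w| ≤ c * D := by
    refine hw.trans ?_
    rw [hD, mul_one_div]
    exact div_le_div_of_nonneg_left hc.le (by positivity) (mul_le_of_le_one_left hM0.le hr1)
  have hcD1 : c * D ≤ c := mul_le_of_le_one_right hc.le hD1
  have hcD0 : 0 < c * D := by positivity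
  have hd3 : |a0 * t1 + a1 * t2 - w| ≤ c * D * G := by
    have h1 : |a0 * t1| ≤ lam * (c * D) := by
      rw [abs_mul, abs_of_pos (hpos ha0)]
      exact mul_le_mul ha0.2 ht1 (abs_nonneg _) hlam0.le
    have h2 : |a1 * t2| ≤ lam * (c * D) := by
      rw [abs_mul, abs_of_pos (hpos ha1)]
      exact mul_le_mul ha1.2 ht2 (abs_nonneg _) hlam0.le
    have e : c * D * G = 2 * (lam * (c * D)) + c * D := by rw [hG]; ring
    rw [e, abs_le]
    have h1' := abs_le.1 h1
    have h2' := abs_le.1 h2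
    have hw'' := abs_le.1 hw'
    constructor <;> linarith only [h1'.1, h1'.2, h2'.1, h2'.2, hw''.1, hw''.2]
  have hcDG : c * D ≤ c * D * G := le_mul_of_one_le_right hcD0.le hG1
  have ht1G : |t1| ≤ c * D * G := ht1.trans hcDG
  have ht2G : |t2| ≤ c * D * G := ht2.trans hcDG
  have hcDG' : c * D * G ≤ 1 / (4 * Λ ^ 2) := by
    exact le_trans (mul_le_mul_of_nonneg_right hcD1 (by linarith)) hc1
  have hΛinv : Λ⁻¹ ≤ 1 := inv_le_one_of_one_le₀ hΛ1
  have hΛ0 : 0 < Λ := by linarith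
  have hsm : 1 / (4 * Λ ^ 2) ≤ 1 / 4 := by
    apply one_div_le_one_div_of_le (by norm_num)
    linarith [one_le_pow₀ hΛ1 (n := 2)]
  have hcle : c ≤ 1 := by
    have : c ≤ c * G := le_mul_of_one_le_right hc.le hG1
    linarith
  -- This is where integrality enters: a nonzero coordinate is at least 1 in absolute value, while
  -- the perturbation is at most `1/4`, so `s` cannot be small.
  have habs : ∀ (l : ℤ) (b d : ℝ), (l : ℝ) = s * b + d → b ∈ Icc Λ⁻¹ Λ → |d| ≤ c * D * G →
      l ≠ 0 → 1 / (2 * Λ) ≤ s := by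
    intro l b d hl hb' hd hl0
    have h1 : (1 : ℝ) ≤ |(l : ℝ)| := by
      rw [← Int.cast_abs]; exact_mod_cast Int.one_le_abs hl0
    have h2 : |(l : ℝ)| ≤ s * Λ + 1 / 4 := by
      rw [hl]
      refine (abs_add_le _ _).trans (add_le_add ?_ (hd.trans (hcDG'.trans hsm)))
      rw [abs_of_nonneg (mul_nonneg hs ((inv_pos.2 hΛ0).le.trans hb'.1))]
      exact mul_le_mul_of_nonneg_left hb'.2 hs
    rw [div_le_iff₀ (by positivity)]
    linarith
  have h1mem : (1 : ℝ) ∈ Icc Λ⁻¹ Λ := ⟨hΛinv, hΛ1⟩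
  have hl2' : (l2 : ℝ) = s * a2 ^ (τ - 1) + 0 := by rw [hl2, add_zero]
  have hl3' : (l3 : ℝ) = s * 1 + (a0 * t1 + a1 * t2 - w) := by rw [hl3]; ring
  have h0G : |(0 : ℝ)| ≤ c * D * G := by rw [abs_zero]; positivity
  have hs0 : 1 / (2 * Λ) ≤ s := by
    by_contra hcon
    refine hne ⟨?_, ?_, ?_, ?_⟩ <;> by_contra h
    · exact hcon (habs l0 _ _ hl0 (hb ha0) ht1G h)
    · exact hcon (habs l1 _ _ hl1 (hb ha1) ht2G h)
    · exact hcon (habs l2 _ _ hl2' (hb ha2) h0G h)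
    · exact hcon (habs l3 _ _ hl3' h1mem hd3 h)
  have hspos : 0 < s := lt_of_lt_of_le (by positivity) hs0
  have hsmall : c * D * G ≤ s / (2 * Λ) := by
    refine hcDG'.trans ?_
    rw [div_le_div_iff₀ (by positivity) (by positivity)]
    rw [div_le_iff₀ (by positivity)] at hs0
    have := mul_le_mul_of_nonneg_right hs0 (by positivity : 0 ≤ 2 * Λ)
    linarith
  -- the normalised point
  have hu : ∀ (l : ℤ) (b d : ℝ), (l : ℝ) = s * b + d → b ∈ Icc Λ⁻¹ Λ → |d| ≤ c * D * G →
      (l : ℝ) = s * (b + d / s) ∧ b + d / s ∈ Icc μ⁻¹ μ ∧ b ∈ Icc μ⁻¹ μ ∧ |d / s| ≤ D * G / s := by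
    intro l b d hl hb' hd
    have hds : |d / s| ≤ 1 / (2 * Λ) := by
      rw [abs_div, abs_of_pos hspos, div_le_iff₀ hspos]
      exact (hd.trans hsmall).trans (le_of_eq (by ring))
    have hμi : μ⁻¹ = 1 / (2 * Λ) := by rw [hμ, one_div]
    have hΛi : Λ⁻¹ = 2 * (1 / (2 * Λ)) := by field_simp
    have hle : 1 / (2 * Λ) ≤ 1 := by rw [div_le_one (by positivity)]; linarith
    have hp : 0 < 1 / (2 * Λ) := by positivity
    have hb1 := hb'.1
    rw [hΛi] at hb1
    refine ⟨by rw [hl]; field_simp, ⟨?_, ?_⟩, ⟨?_, ?_⟩, ?_⟩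
    · rw [hμi]; linarith [(abs_le.1 hds).1]
    · rw [hμ]; linarith [(abs_le.1 hds).2, hb'.2]
    · rw [hμi]; linarith
    · rw [hμ]; linarith [hb'.2]
    · rw [abs_div, abs_of_pos hspos]
      refine div_le_div_of_nonneg_right (hd.trans ?_) hspos.le
      rw [mul_assoc]
      exact mul_le_of_le_one_left (by positivity) hcle
  obtain ⟨k0, m0, n0, d0⟩ := hu l0 _ _ hl0 (hb ha0) ht1G
  obtain ⟨k1, m1, n1, d1⟩ := hu l1 _ _ hl1 (hb ha1) ht2G
  obtain ⟨k2, m2, n2, d2⟩ := hu l2 _ _ hl2' (hb ha2) h0G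
  obtain ⟨k3, m3, n3, d3⟩ := hu l3 _ _ hl3' h1mem hd3
  have hmem : ∀ (l : ℤ) (u : ℝ), (l : ℝ) = s * u → u ∈ Icc μ⁻¹ μ → (l : ℝ) ∈ Icc (s / μ) (μ * s) := by
    intro l u hl hu'
    rw [hl, div_eq_mul_inv, mul_comm μ s]
    exact ⟨mul_le_mul_of_nonneg_left hu'.1 hs, mul_le_mul_of_nonneg_left hu'.2 hs⟩
  have hratio : ∀ (l : ℤ) (a t : ℝ), a ∈ Icc lam⁻¹ lam → (l : ℝ) = s * (a ^ (τ - 1) + t / s) →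
      a ^ (τ - 1) + t / s ∈ Icc μ⁻¹ μ → |t / s| ≤ D * G / s →
      |a - ((l : ℝ) / l3) ^ (τ - 1)⁻¹| ≤ C / (r * M * s) := by
    intro l a t haa hl hm hd
    set δ3 := (a0 * t1 + a1 * t2 - w) / s with hδ3
    have hu3 : 0 < 1 + δ3 := (inv_pos.2 hμ0).trans_le m3.1
    have hq : (l : ℝ) / l3 = (a ^ (τ - 1) + t / s) / (1 + δ3) := by
      rw [hl, k3, mul_div_mul_left _ _ hspos.ne']
    have hqm : (l : ℝ) / l3 ∈ Icc (μ ^ 2)⁻¹ (μ ^ 2) := by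
      rw [hq]
      constructor
      · rw [le_div_iff₀ hu3, inv_mul_le_iff₀ (by positivity)]
        have h3 : 1 ≤ μ * (a ^ (τ - 1) + t / s) := by
          rw [← inv_mul_le_iff₀ hμ0, mul_one]; exact hm.1
        rw [pow_two, mul_assoc]
        exact m3.2.trans (le_mul_of_one_le_right hμ0.le h3)
      · rw [div_le_iff₀ hu3]
        have : 1 ≤ μ * (1 + δ3) := by
          rw [← inv_mul_le_iff₀ hμ0, mul_one]; exact m3.1
        rw [pow_two, mul_assoc]
        exact hm.2.trans (le_mul_of_one_le_right hμ0.le this)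
    have ham : a ^ (τ - 1) ∈ Icc (μ ^ 2)⁻¹ (μ ^ 2) := by
      have := hb haa
      have hle : Λ ≤ μ ^ 2 := by
        rw [pow_two]
        exact (by linarith : Λ ≤ μ).trans (le_mul_of_one_le_right hμ0.le hμ1)
      exact ⟨(inv_anti₀ hΛ0 hle).trans this.1, this.2.trans hle⟩
    have h1 := hL _ ham _ hqm
    rw [Real.rpow_rpow_inv (hpos haa).le hτ0.ne'] at h1
    refine h1.trans ?_
    have h2 : |a ^ (τ - 1) - (l : ℝ) / l3| ≤ μ * ((1 + Λ) * (D * G / s)) := by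
      rw [hq]
      have e : a ^ (τ - 1) - (a ^ (τ - 1) + t / s) / (1 + δ3) =
          (1 + δ3)⁻¹ * (a ^ (τ - 1) * δ3 - t / s) := by
        field_simp; ring
      rw [e, abs_mul, abs_of_pos (inv_pos.2 hu3)]
      refine mul_le_mul ?_ ?_ (abs_nonneg _) hμ0.le
      · rw [inv_le_comm₀ hu3 hμ0]; exact m3.1
      · refine (abs_sub _ _).trans ?_
        rw [abs_mul, abs_of_pos ((inv_pos.2 hΛ0).trans_le (hb haa).1)]
        have := mul_le_mul (hb haa).2 d3 (abs_nonneg _) hΛ0.le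
        linarith
    refine (mul_le_mul_of_nonneg_left h2 hL0).trans ?_
    have e : L * (μ * ((1 + Λ) * (D * G / s))) = L * (μ * ((1 + Λ) * G)) / (r * M * s) := by
      rw [hD]; field_simp
    rw [e]
    refine div_le_div_of_nonneg_right ?_ (by positivity)
    rw [hC]
    have : 0 ≤ A + β + 3 * T * G ^ 2 := by positivity
    linarith
  refine ⟨by rw [hμ, ← one_div]; exact hs0, hmem _ _ k0 m0, hmem _ _ k1 m1, hmem _ _ k2 m2,
    hmem _ _ k3 m3, ?_, hratio l0 a0 t1 ha0 k0 m0 d0, hratio l1 a1 t2 ha1 k1 m1 d1⟩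
  set δ0 := t1 / s
  set δ1 := t2 / s
  set δ3 := (a0 * t1 + a1 * t2 - w) / s with hδ3
  have v0 := hT _ m0 _ n0
  have v1 := hT _ m1 _ n1
  have v3 := hT _ m3 _ n3
  -- Conjugacy of exponents: the power `β` sends the normal `a ^ (τ - 1)` to `a ^ τ`, and its
  -- derivative there returns `a` up to the factor `β`.
  have pw : ∀ {x : ℝ}, x ∈ Icc lam⁻¹ lam → (x ^ (τ - 1)) ^ β = x ^ τ := fun {x} hx => by
    rw [← Real.rpow_mul (hpos hx).le, hβ, mul_div_cancel₀ _ hτ0.ne']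
  have pw' : ∀ {x : ℝ}, x ∈ Icc lam⁻¹ lam → (x ^ (τ - 1)) ^ (β - 1) = x := fun {x} hx => by
    rw [hβ1, Real.rpow_rpow_inv (hpos hx).le hτ0.ne']
  rw [pw ha0, pw' ha0, add_sub_cancel_left] at v0
  rw [pw ha1, pw' ha1, add_sub_cancel_left] at v1
  rw [Real.one_rpow, Real.one_rpow, add_sub_cancel_left] at v3
  have sq_le : ∀ {u : ℝ}, |u| ≤ D * G / s → T * u ^ 2 ≤ T * G ^ 2 / s ^ 2 := fun {u} h => by
    rw [← sq_abs u, mul_div_assoc, ← div_pow]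
    refine mul_le_mul_of_nonneg_left (pow_le_pow_left₀ (abs_nonneg _) (h.trans ?_) 2) hT0
    exact div_le_div_of_nonneg_right (mul_le_of_le_one_left (by linarith) hD1) hs
  have v0' := v0.trans (sq_le d0)
  have v1' := v1.trans (sq_le d1)
  have v3' := v3.trans (sq_le d3)
  -- The tangential directions are annihilated by the gradient of the dual form at the normal, so
  -- `t1` and `t2` cancel to first order and only `w` survives.
  have hlin : a0 * δ0 + a1 * δ1 - δ3 = w / s := by
    rw [hδ3]; simp only [δ0, δ1]; field_simp; ring
  have hK2 : s * (r ^ 2 * M) ≤ c := by rwa [le_div_iff₀ (by positivity)] at hsK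
  -- Since `s * r ≤ s * r ^ 2 * M * 1` by `1 ≤ r * M`, and this is at most `c ≤ 1`, the defect of
  -- order `r ^ 2` is within the critical precision `1 / s ^ 2`.
  have hAr : A * r ^ 2 ≤ A / s ^ 2 := by
    rw [le_div_iff₀ (by positivity), mul_assoc]
    refine mul_le_of_le_one_right hA ?_
    have h1 : s * r ≤ 1 := by
      have : s * r * 1 ≤ s * r * (r * M) := mul_le_mul_of_nonneg_left hrM (by positivity)
      linarith
    rw [← mul_pow, mul_comm r s]
    exact pow_le_one₀ (by positivity) h1
  have hwb : |β * (w / s)| ≤ β / s ^ 2 := by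
    rw [abs_mul, abs_of_pos hβ0, abs_div, abs_of_pos hspos, ← mul_div_assoc,
      div_le_div_iff₀ hspos (by positivity)]
    have h1 : |w| * s ≤ 1 := by
      have h2 : |w| * M ≤ c := by rwa [le_div_iff₀ hM0] at hw
      have h3 : s ≤ M := by
        have h4 : s * (r ^ 2 * M) * M ≤ 1 * M :=
          mul_le_mul_of_nonneg_right (hK2.trans hcle) hM0.le
        have h5 : 1 ≤ (r * M) ^ 2 := one_le_pow₀ hrM
        have h6 : s * 1 ≤ s * (r * M) ^ 2 := mul_le_mul_of_nonneg_left h5 hs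
        linarith
      have h7 := mul_le_mul_of_nonneg_left h3 (abs_nonneg w)
      linarith
    have : β * s * (|w| * s) ≤ β * s * 1 := mul_le_mul_of_nonneg_left h1 (by positivity)
    linarith
  have hsum : |(a0 ^ (τ - 1) + δ0) ^ β + (a1 ^ (τ - 1) + δ1) ^ β - (a2 ^ (τ - 1)) ^ β
      - (1 + δ3) ^ β| ≤ C / s ^ 2 := by
    have e : (a0 ^ (τ - 1) + δ0) ^ β + (a1 ^ (τ - 1) + δ1) ^ β - (a2 ^ (τ - 1)) ^ β
      - (1 + δ3) ^ β = (a0 ^ τ + a1 ^ τ - a2 ^ τ - 1) + β * (w / s)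
        + ((a0 ^ (τ - 1) + δ0) ^ β - a0 ^ τ - β * a0 * δ0)
        + ((a1 ^ (τ - 1) + δ1) ^ β - a1 ^ τ - β * a1 * δ1)
        - ((1 + δ3) ^ β - 1 - β * 1 * δ3) := by
      rw [← hlin, pw ha2]; ring
    have e2 : C / s ^ 2 = A / s ^ 2 + β / s ^ 2 + 3 * (T * G ^ 2 / s ^ 2) +
        L * (μ * ((1 + Λ) * G)) / s ^ 2 := by rw [hC]; ring
    have e3 : 0 ≤ L * (μ * ((1 + Λ) * G)) / s ^ 2 := by positivity
    have ha' := ha.trans hAr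
    rw [e, e2]
    rw [abs_le] at ha' hwb v0' v1' v3' ⊢
    constructor <;>
      linarith only [ha'.1, ha'.2, hwb.1, hwb.2, v0'.1, v0'.2, v1'.1, v1'.2, v3'.1, v3'.2, e3]
  have hu0 : ∀ {u : ℝ}, u ∈ Icc μ⁻¹ μ → 0 ≤ u := fun h => (inv_pos.2 hμ0).le.trans h.1
  rw [zero_div, add_zero] at k2 m2
  rw [k0, k1, k2, k3, Real.mul_rpow hs (hu0 m0), Real.mul_rpow hs (hu0 m1),
    Real.mul_rpow hs (hu0 m2), Real.mul_rpow hs (hu0 m3), ← mul_add, ← mul_sub, ← mul_sub, abs_mul,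
    abs_of_pos (Real.rpow_pos_of_pos hspos _), Real.rpow_sub hspos]
  rw [Real.rpow_two, mul_div_assoc', mul_comm C, ← mul_div_assoc']
  exact mul_le_mul_of_nonneg_left hsum (Real.rpow_pos_of_pos hspos _).le

/-! ### Dual boxes and transference for caps -/

/-- The integer points of the box spanned by the normal `(n₀, n₁, -n₂, -1)` and the tangential
directions `(1, 0, 0, -a₀)`, `(0, 1, 0, -a₁)`, with side lengths `b₀`, `b₁`, `b₁`, `b₃`. -/
def DualBox (n0 n1 n2 a0 a1 b0 b1 b3 : ℝ) (k : Fin 4 → ℤ) : Prop :=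
  ∃ s t1 t2 w : ℝ, |s| ≤ b0 ∧ |t1| ≤ b1 ∧ |t2| ≤ b1 ∧ |w| ≤ b3 ∧
    (k 0 : ℝ) = s * n0 + t1 ∧ (k 1 : ℝ) = s * n1 + t2 ∧ (k 2 : ℝ) = -(s * n2) ∧
    (k 3 : ℝ) = -(s + a0 * t1 + a1 * t2 - w)

lemma finite_dualBox (n0 n1 n2 a0 a1 b0 b1 b3 : ℝ) :
    {k | DualBox n0 n1 n2 a0 a1 b0 b1 b3 k}.Finite := by
  set B := max (max (b0 * |n0| + b1) (b0 * |n1| + b1))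
    (max (b0 * |n2|) (b0 + |a0| * b1 + |a1| * b1 + b3)) with hB
  have hfin : (univ.pi fun _ : Fin 4 => Icc (-⌈B⌉) ⌈B⌉).Finite :=
    Finite.pi fun _ => finite_Icc _ _
  refine hfin.subset ?_
  rintro k ⟨s, t1, t2, w, hs, h1, h2, hw, k0, k1, k2, k3⟩
  have key : ∀ i, |(k i : ℝ)| ≤ B := by
    intro i
    fin_cases i
    · refine le_trans ?_ ((le_max_left _ _).trans (le_max_left _ _))
      show |(k 0 : ℝ)| ≤ _
      rw [k0]
      exact (abs_add_le _ _).trans (add_le_add (by rw [abs_mul]; gcongr) h1)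
    · refine le_trans ?_ ((le_max_right _ _).trans (le_max_left _ _))
      show |(k 1 : ℝ)| ≤ _
      rw [k1]
      exact (abs_add_le _ _).trans (add_le_add (by rw [abs_mul]; gcongr) h2)
    · refine le_trans ?_ ((le_max_left _ _).trans (le_max_right _ _))
      show |(k 2 : ℝ)| ≤ _
      rw [k2, abs_neg, abs_mul]; gcongr
    · refine le_trans ?_ ((le_max_right _ _).trans (le_max_right _ _))
      show |(k 3 : ℝ)| ≤ _
      rw [k3, abs_neg]
      refine (abs_sub _ _).trans (add_le_add ((abs_add_le _ _).trans
        (add_le_add ((abs_add_le _ _).trans (add_le_add hs ?_)) ?_)) hw) <;>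
      · rw [abs_mul]; gcongr
  intro i _
  have h := abs_le.1 ((key i).trans (Int.le_ceil B))
  constructor
  · exact_mod_cast h.1
  · exact_mod_cast h.2

/-- Pairing `x` with a point of parameters `(s, t1, t2, w)` gives four terms, one for each
hypothesis `h0` to `h3`, each at most 1/24, hence at most the 1/6 needed for transference. The body
used has nonnegative parameters, so that its differences fall in `DualBox`; the parametrising map
has determinant `n2` in absolute value. -/
lemma card_le_of_dualBox {n0 n1 n2 a0 a1 b0 b1 b3 : ℝ} (hn2 : 0 < n2) (hb0 : 0 < b0) (hb1 : 0 < b1)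
    (hb3 : 0 < b3) (X Z : Finset (Fin 4 → ℤ))
    (hZ : ∀ k, DualBox n0 n1 n2 a0 a1 b0 b1 b3 k → k ∈ Z)
    (h0 : ∀ x ∈ X, |n0 * x 0 + n1 * x 1 - n2 * x 2 - x 3| * b0 ≤ 1 / 24)
    (h1 : ∀ x ∈ X, |(x 0 : ℝ) - a0 * x 3| * b1 ≤ 1 / 24)
    (h2 : ∀ x ∈ X, |(x 1 : ℝ) - a1 * x 3| * b1 ≤ 1 / 24)
    (h3 : ∀ x ∈ X, |(x 3 : ℝ)| * b3 ≤ 1 / 24) :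
    (X.card : ℝ) * (n2 * (b0 * b1 * b1 * b3)) ≤ 4 * Z.card := by
  set A : Matrix (Fin 4) (Fin 4) ℝ := !![n0, 1, 0, 0; n1, 0, 1, 0; -n2, 0, 0, 0; -1, -a0, -a1, 1]
    with hA
  set b : Fin 4 → ℝ := ![b0, b1, b1, b3] with hb
  have hdet : |LinearMap.det (Matrix.toLin' A)| = n2 := by
    rw [LinearMap.det_toLin', hA]
    simp [Matrix.det_succ_row_zero, Fin.sum_univ_succ, Fin.succAbove, abs_of_pos hn2]
  have happ : ∀ v : Fin 4 → ℝ, Matrix.toLin' A v 0 = v 0 * n0 + v 1 ∧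
      Matrix.toLin' A v 1 = v 0 * n1 + v 2 ∧ Matrix.toLin' A v 2 = -(v 0 * n2) ∧
      Matrix.toLin' A v 3 = -(v 0 + a0 * v 1 + a1 * v 2 - v 3) := by
    intro v
    simp only [Matrix.toLin'_apply, hA, Matrix.mulVec, dotProduct, Fin.sum_univ_four]
    simp
    refine ⟨by ring, by ring, by ring, by ring⟩
  set D : Set (Fin 4 → ℝ) := Matrix.toLin' A '' (univ.pi fun i => Icc 0 (b i)) with hD
  have hcont : Continuous (Matrix.toLin' A) := LinearMap.continuous_of_finiteDimensional _
  have hDm : MeasurableSet D :=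
    ((isCompact_univ_pi fun i => isCompact_Icc).image hcont).measurableSet
  have hvol : volume D = ENNReal.ofReal (n2 * (b0 * b1 * b1 * b3)) := by
    rw [hD, Measure.addHaar_image_linearMap, hdet, volume_pi_pi, Fin.prod_univ_four,
      ENNReal.ofReal_mul hn2.le, ENNReal.ofReal_mul (by positivity),
      ENNReal.ofReal_mul (by positivity), ENNReal.ofReal_mul (by positivity)]
    simp [hb]
  have hmem : ∀ v ∈ (univ.pi fun i => Icc 0 (b i)), (0 ≤ v 0 ∧ v 0 ≤ b0) ∧ (0 ≤ v 1 ∧ v 1 ≤ b1) ∧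
      (0 ≤ v 2 ∧ v 2 ≤ b1) ∧ (0 ≤ v 3 ∧ v 3 ≤ b3) := fun v hv =>
    ⟨hv 0 (mem_univ _), hv 1 (mem_univ _), hv 2 (mem_univ _), hv 3 (mem_univ _)⟩
  have key := card_mul_volume_le X Z D hDm ?_ ?_
  · rw [hvol] at key
    have h := ENNReal.toReal_mono (by finiteness) key
    rw [ENNReal.toReal_mul, ENNReal.toReal_ofReal (by positivity)] at h
    simpa using h
  · rintro x hx _ ⟨v, hv, rfl⟩
    obtain ⟨e0, e1, e2, e3⟩ := happ v
    obtain ⟨v0, v1, v2, v3⟩ := hmem v hv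
    rw [Fin.sum_univ_four, e0, e1, e2, e3]
    have hm : ∀ {y u c : ℝ}, |y| * c ≤ 1 / 24 → 0 ≤ u ∧ u ≤ c → |y * u| ≤ 1 / 24 :=
      fun {y u c} h hu => by
        rw [abs_mul, abs_of_nonneg hu.1]
        exact (mul_le_mul_of_nonneg_left hu.2 (abs_nonneg _)).trans h
    have f0 := abs_le.1 (hm (h0 x hx) v0)
    have f1 := abs_le.1 (hm (h1 x hx) v1)
    have f2 := abs_le.1 (hm (h2 x hx) v2)
    have f3 := abs_le.1 (hm (h3 x hx) v3)
    rw [abs_le]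
    constructor <;> linarith only [f0.1, f1.1, f2.1, f3.1, f0.2, f1.2, f2.2, f3.2]
  · rintro k _ ⟨v, hv, rfl⟩ ⟨u, hu, huv⟩
    obtain ⟨e0, e1, e2, e3⟩ := happ v
    obtain ⟨v0, v1, v2, v3⟩ := hmem v hv
    obtain ⟨g0, g1, g2, g3⟩ := happ u
    obtain ⟨u0, u1, u2, u3⟩ := hmem u hu
    have hk : ∀ i, (k i : ℝ) = Matrix.toLin' A u i - Matrix.toLin' A v i := fun i => by
      rw [huv, Pi.add_apply]; ring
    have hab : ∀ {x y c : ℝ}, 0 ≤ x ∧ x ≤ c → 0 ≤ y ∧ y ≤ c → |x - y| ≤ c := fun {x y c} hx hy => by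
      rw [abs_le]; constructor <;> linarith [hx.1, hx.2, hy.1, hy.2]
    refine hZ k ⟨u 0 - v 0, u 1 - v 1, u 2 - v 2, u 3 - v 3, hab u0 v0, hab u1 v1, hab u2 v2,
      hab u3 v3, ?_, ?_, ?_, ?_⟩
    · rw [hk, g0, e0]; ring
    · rw [hk, g1, e1]; ring
    · rw [hk, g2, e2]; ring
    · rw [hk, g3, e3]; ring

/-! ### Near solutions and their caps -/

/-- `x` is an integer quadruple of size about `M`, with `x₀ ^ τ + x₁ ^ τ - x₂ ^ τ - x₃ ^ τ`
at most `A r² M ^ τ` in absolute value. -/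
def NearSolution (τ lam A M r : ℝ) (x : Fin 4 → ℤ) : Prop :=
  (∀ i, M / lam ≤ x i ∧ (x i : ℝ) ≤ lam * M) ∧
    |(x 0 : ℝ) ^ τ + (x 1 : ℝ) ^ τ - (x 2 : ℝ) ^ τ - (x 3 : ℝ) ^ τ| ≤ A * r ^ 2 * M ^ τ

/-- There are `O(M ^ (2 + ξ))` quadruples of size `M` with
`x₀ ^ τ + x₁ ^ τ - x₂ ^ τ - x₃ ^ τ = O(M ^ (τ - 2))`. -/
def NearSolutionBound (τ ξ : ℝ) : Prop :=
  ∀ lam A : ℝ, 1 ≤ lam → 0 ≤ A → ∃ C, 0 ≤ C ∧ ∀ M : ℝ, 1 ≤ M → ∀ X : Finset (Fin 4 → ℤ),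
    (∀ x ∈ X, NearSolution τ lam A M M⁻¹ x) → (X.card : ℝ) ≤ C * M ^ (2 + ξ)

lemma NearSolution.pos {τ lam A M r : ℝ} {x : Fin 4 → ℤ} (hlam : 1 ≤ lam) (hM : 1 ≤ M)
    (hx : NearSolution τ lam A M r x) (i : Fin 4) : (0 : ℝ) < x i :=
  (by positivity : 0 < M / lam).trans_le (hx.1 i).1

lemma NearSolution.ratio_mem {τ lam A M r : ℝ} {x : Fin 4 → ℤ} (hlam : 1 ≤ lam) (hM : 1 ≤ M)
    (hx : NearSolution τ lam A M r x) (i : Fin 4) :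
    (x i : ℝ) / x 3 ∈ Icc (lam ^ 2)⁻¹ (lam ^ 2) := by
  have h0 : 0 < lam := by linarith
  have h3 := hx.pos hlam hM 3
  have hi := hx.1 i
  have h3' := hx.1 3
  rw [div_le_iff₀ h0] at hi h3'
  constructor
  · rw [le_div_iff₀ h3, inv_mul_le_iff₀ (by positivity)]
    nlinarith
  · rw [div_le_iff₀ h3]
    nlinarith

/-- Homogeneity: dividing by `x 3 ^ τ` projects the quadruple to the surface, and the factor `lam ^
τ` pays for `x 3 ≥ M / lam`. -/
lemma NearSolution.ratio_surface {τ lam A M r : ℝ} {x : Fin 4 → ℤ} (hτ : 0 ≤ τ) (hlam : 1 ≤ lam)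
    (hM : 1 ≤ M) (hA : 0 ≤ A) (hx : NearSolution τ lam A M r x) :
    |((x 0 : ℝ) / x 3) ^ τ + ((x 1 : ℝ) / x 3) ^ τ - ((x 2 : ℝ) / x 3) ^ τ - 1| ≤
      (A * lam ^ τ) * r ^ 2 := by
  have h0 : 0 < lam := by linarith
  have hM0 : 0 < M := by linarith
  have hp := hx.pos hlam hM
  have h3 : 0 < (x 3 : ℝ) ^ τ := Real.rpow_pos_of_pos (hp 3) _
  rw [Real.div_rpow (hp 0).le (hp 3).le, Real.div_rpow (hp 1).le (hp 3).le,
    Real.div_rpow (hp 2).le (hp 3).le]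
  have e : (x 0 : ℝ) ^ τ / (x 3 : ℝ) ^ τ + (x 1 : ℝ) ^ τ / (x 3 : ℝ) ^ τ
      - (x 2 : ℝ) ^ τ / (x 3 : ℝ) ^ τ - 1 =
      ((x 0 : ℝ) ^ τ + (x 1 : ℝ) ^ τ - (x 2 : ℝ) ^ τ - (x 3 : ℝ) ^ τ) / (x 3 : ℝ) ^ τ := by
    field_simp
  rw [e, abs_div, abs_of_pos h3, div_le_iff₀ h3]
  refine hx.2.trans ?_
  have h5 : M ^ τ ≤ lam ^ τ * (x 3 : ℝ) ^ τ := by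
    rw [← Real.mul_rpow h0.le (hp 3).le]
    refine Real.rpow_le_rpow hM0.le ?_ hτ
    have := (hx.1 3).1
    rw [div_le_iff₀ h0] at this
    linarith
  have := mul_le_mul_of_nonneg_left h5 (by positivity : 0 ≤ A * r ^ 2)
  linarith

/-- The dual box attached to the cap of width `r` at the point `(a₀, a₁, a₂, 1)`. -/
def CapDual (τ c M r a0 a1 a2 : ℝ) (k : Fin 4 → ℤ) : Prop :=
  DualBox (a0 ^ (τ - 1)) (a1 ^ (τ - 1)) (a2 ^ (τ - 1)) a0 a1 (c / (r ^ 2 * M)) (c / (r * M)) (c / M)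
    k

/-- The number of near solutions in a cap is controlled by the number of points in its dual box. -/
lemma exists_cap_card_le (τ lam A : ℝ) (hτ : 1 < τ) (hlam : 1 ≤ lam) (hA : 0 ≤ A) :
    ∃ c1, 0 < c1 ∧ ∀ c, 0 < c → c ≤ c1 → ∃ C, 0 ≤ C ∧ ∀ M r, 1 ≤ M → 0 < r → r ≤ 1 →
      ∀ p, NearSolution τ lam A M r p → ∀ X Z : Finset (Fin 4 → ℤ),
      (∀ x ∈ X, NearSolution τ lam A M r x ∧ |(x 0 : ℝ) / x 3 - p 0 / p 3| ≤ r ∧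
        |(x 1 : ℝ) / x 3 - p 1 / p 3| ≤ r) →
      (∀ k, CapDual τ c M r (p 0 / p 3) (p 1 / p 3) (p 2 / p 3) k → k ∈ Z) →
      (X.card : ℝ) ≤ C * (r ^ 4 * M ^ 4) * Z.card := by
  have hlam0 : 0 < lam := by linarith
  have hlam2 : 1 ≤ lam ^ 2 := one_le_pow₀ hlam
  obtain ⟨T, hT0, hT⟩ := exists_tangent_bound τ (lam ^ 2) (A * lam ^ τ) hτ hlam2 (by positivity)
  refine ⟨1 / (24 * (lam * (T + 1))), by positivity, fun c hc hc1 => ?_⟩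
  set Λ := (lam ^ 2) ^ (τ - 1) with hΛ
  have hΛ0 : 0 < Λ := by positivity
  refine ⟨4 * Λ / c ^ 4, by positivity, fun M r hM hr hr1 p hp X Z hX hZ => ?_⟩
  have hM0 : 0 < M := by linarith
  have hcT : c * (lam * (T + 1)) ≤ 1 / 24 := by
    rw [le_div_iff₀ (by positivity)] at hc1
    linarith
  have hcl : c * lam ≤ 1 / 24 := by
    have : c * lam ≤ c * (lam * (T + 1)) :=
      mul_le_mul_of_nonneg_left (le_mul_of_one_le_right hlam0.le (by linarith)) hc.le
    linarith
  have hcTl : c * (lam * T) ≤ 1 / 24 := by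
    have : c * (lam * T) ≤ c * (lam * (T + 1)) := by gcongr; linarith
    linarith
  have ha2 := hp.ratio_mem hlam hM 2
  have hn2 : ((p 2 : ℝ) / p 3) ^ (τ - 1) ∈ Icc Λ⁻¹ Λ :=
    rpow_mem_Icc_inv hlam2 (by linarith) ha2
  have hn2pos : 0 < ((p 2 : ℝ) / p 3) ^ (τ - 1) := (inv_pos.2 hΛ0).trans_le hn2.1
  have key := card_le_of_dualBox hn2pos (b0 := c / (r ^ 2 * M)) (b1 := c / (r * M)) (b3 := c / M)
    (by positivity) (by positivity) (by positivity) X Z hZ ?_ ?_ ?_ ?_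
  · have e : c / (r ^ 2 * M) * (c / (r * M)) * (c / (r * M)) * (c / M) = c ^ 4 / (r ^ 4 * M ^ 4) := by
      field_simp
    rw [e] at key
    have h1 : (X.card : ℝ) * (Λ⁻¹ * (c ^ 4 / (r ^ 4 * M ^ 4))) ≤ 4 * Z.card := by
      refine le_trans ?_ key
      gcongr
      exact hn2.1
    have e2 : (X.card : ℝ) = (X.card : ℝ) * (Λ⁻¹ * (c ^ 4 / (r ^ 4 * M ^ 4))) *
        (Λ * (r ^ 4 * M ^ 4) / c ^ 4) := by field_simp
    rw [e2]
    refine (mul_le_mul_of_nonneg_right h1 (by positivity)).trans (le_of_eq ?_)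
    ring
  all_goals
    intro x hx
    obtain ⟨hxs, d0, d1⟩ := hX x hx
    have h3 := hxs.pos hlam hM 3
    have h3M := (hxs.1 3).2
  · have h := hT r hr hr1 _ (hxs.ratio_mem hlam hM 0) _ (hxs.ratio_mem hlam hM 1) _
      (hxs.ratio_mem hlam hM 2) _ (hp.ratio_mem hlam hM 0) _ (hp.ratio_mem hlam hM 1) _
      (hp.ratio_mem hlam hM 2) d0 d1 (hxs.ratio_surface (by linarith) hlam hM hA)
      (hp.ratio_surface (by linarith) hlam hM hA)
    set n0 := ((p 0 : ℝ) / p 3) ^ (τ - 1)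
    set n1 := ((p 1 : ℝ) / p 3) ^ (τ - 1)
    set n2 := ((p 2 : ℝ) / p 3) ^ (τ - 1)
    have e : n0 * x 0 + n1 * x 1 - n2 * x 2 - x 3 =
        x 3 * (n0 * (x 0 / x 3) + n1 * (x 1 / x 3) - n2 * (x 2 / x 3) - 1) := by
      field_simp
    rw [e, abs_mul, abs_of_pos h3]
    calc _ ≤ (lam * M * (T * r ^ 2)) * (c / (r ^ 2 * M)) := by gcongr
      _ = c * (lam * T) := by field_simp
      _ ≤ _ := hcTl
  · have e : (x 0 : ℝ) - p 0 / p 3 * x 3 = x 3 * (x 0 / x 3 - p 0 / p 3) := by field_simp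
    rw [e, abs_mul, abs_of_pos h3]
    calc _ ≤ (lam * M * r) * (c / (r * M)) := by gcongr
      _ = c * lam := by field_simp
      _ ≤ _ := hcl
  · have e : (x 1 : ℝ) - p 1 / p 3 * x 3 = x 3 * (x 1 / x 3 - p 1 / p 3) := by field_simp
    rw [e, abs_mul, abs_of_pos h3]
    calc _ ≤ (lam * M * r) * (c / (r * M)) := by gcongr
      _ = c * lam := by field_simp
      _ ≤ _ := hcl
  · rw [abs_of_pos h3]
    calc _ ≤ (lam * M) * (c / M) := by gcongr
      _ = c * lam := by field_simp
      _ ≤ _ := hcl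

/-! ### Dual points as near solutions for the conjugate exponent -/

/-- The sign changes that turn dual points into near solutions for the dual exponent. -/
def dualFlip (k : Fin 4 → ℤ) : Fin 4 → ℤ :=
  if 0 < k 0 then ![k 0, k 1, -k 2, -k 3] else ![-k 0, -k 1, k 2, k 3]

lemma eq_or_eq_of_dualFlip_eq {k l : Fin 4 → ℤ} (h : dualFlip k = l) :
    k = ![l 0, l 1, -l 2, -l 3] ∨ k = ![-l 0, -l 1, l 2, l 3] := by
  subst h
  unfold dualFlip
  split_ifs
  · left; ext i; fin_cases i <;> simp
  · right; ext i; fin_cases i <;> simp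

/-- The dyadic size of a dual point. -/
def dualScale (k : Fin 4 → ℤ) : ℕ := Nat.log 2 (dualFlip k 3).toNat

/-- A nonzero dual point gives a near solution for the dual exponent, of dyadic size at most
`O(1 / (r² M))`, and it determines its cap up to `O(1 / (r² M))` over its size. -/
lemma exists_capDual_spec (τ lam A : ℝ) (hτ : 1 < τ) (hlam : 1 ≤ lam) (hA : 0 ≤ A) :
    ∃ c0 lam' A' E, 0 < c0 ∧ c0 ≤ 1 ∧ 1 ≤ lam' ∧ 0 ≤ A' ∧ 0 ≤ E ∧ ∀ c, 0 < c → c ≤ c0 →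
      ∀ M r, 1 ≤ M → 1 ≤ r * M → r ≤ 1 → ∀ a0 ∈ Icc lam⁻¹ lam, ∀ a1 ∈ Icc lam⁻¹ lam,
      ∀ a2 ∈ Icc lam⁻¹ lam, |a0 ^ τ + a1 ^ τ - a2 ^ τ - 1| ≤ A * r ^ 2 → ∀ k,
      CapDual τ c M r a0 a1 a2 k → k ≠ 0 →
      NearSolution (τ / (τ - 1)) lam' A' (2 ^ dualScale k) (2 ^ dualScale k)⁻¹ (dualFlip k) ∧
      (2 : ℝ) ^ dualScale k ≤ lam' * (1 / (r ^ 2 * M)) ∧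
      |a0 - ((dualFlip k 0 : ℝ) / dualFlip k 3) ^ (τ - 1)⁻¹| ≤ E / (r * M * 2 ^ dualScale k) ∧
      |a1 - ((dualFlip k 1 : ℝ) / dualFlip k 3) ^ (τ - 1)⁻¹| ≤ E / (r * M * 2 ^ dualScale k) := by
  obtain ⟨c0, μ, C, hc00, hc01, hμ1, hC0, hdual⟩ := exists_dual_bound τ lam A hτ hlam hA
  have hμ0 : 0 < μ := by linarith
  set β := τ / (τ - 1) with hβ
  obtain ⟨B, hB0, hB⟩ := exists_abs_rpow_le (β - 2) (2 * μ) (by linarith)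
  refine ⟨c0, 2 * μ ^ 2, C * B, C * μ, hc00, hc01, ?_, by positivity, by positivity, ?_⟩
  · nlinarith [one_le_pow₀ hμ1 (n := 2)]
  intro c hc hcc M r hM hrM hr1 a0 ha0 a1 ha1 a2 ha2 ha k hk hk0
  have hM0 : 0 < M := by linarith
  have hr0 : 0 < r := by
    by_contra h; push Not at h
    linarith [mul_nonpos_of_nonpos_of_nonneg h hM0.le]
  -- a nonnegative parameter for the flipped point
  have main : ∃ s, μ⁻¹ ≤ s ∧ s ≤ c / (r ^ 2 * M) ∧
      (∀ i, (dualFlip k i : ℝ) ∈ Icc (s / μ) (μ * s)) ∧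
      |(dualFlip k 0 : ℝ) ^ β + (dualFlip k 1 : ℝ) ^ β - (dualFlip k 2 : ℝ) ^ β
        - (dualFlip k 3 : ℝ) ^ β| ≤ C * s ^ (β - 2) ∧
      |a0 - ((dualFlip k 0 : ℝ) / dualFlip k 3) ^ (τ - 1)⁻¹| ≤ C / (r * M * s) ∧
      |a1 - ((dualFlip k 1 : ℝ) / dualFlip k 3) ^ (τ - 1)⁻¹| ≤ C / (r * M * s) := by
    obtain ⟨s, t1, t2, w, hs, h1, h2, hw, k0, k1, k2, k3⟩ := hk
    have hneg : ∀ l0 l1 l2 l3 : ℤ, (k 0 = l0 ∧ k 1 = l1 ∧ k 2 = l2 ∧ k 3 = l3) →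
        ¬ (l0 = 0 ∧ l1 = 0 ∧ l2 = 0 ∧ l3 = 0) := by
      rintro l0 l1 l2 l3 ⟨rfl, rfl, rfl, rfl⟩ ⟨e0, e1, e2, e3⟩
      refine hk0 (funext fun i => ?_)
      fin_cases i <;> assumption
    have hneg' := hneg _ _ _ _ ⟨rfl, rfl, rfl, rfl⟩
    -- The dual box is symmetric, so a negative `s` is handled by negating the vector. The first
    -- coordinate has the sign of `s`, which is why `dualFlip` may branch on it.
    rcases le_total 0 s with hs0 | hs0
    · rw [abs_of_nonneg hs0] at hs
      obtain ⟨m, m0, m1, m2, m3, r1, r2, r3⟩ := hdual c hc hcc M r hM hrM hr1 a0 ha0 a1 ha1 a2 ha2 ha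
        s t1 t2 w hs0 hs h1 h2 hw (k 0) (k 1) (-k 2) (-k 3) k0 k1 (by push_cast; linarith)
        (by push_cast; linarith) (by simpa using hneg')
      have hspos : 0 < s := (inv_pos.2 hμ0).trans_le m
      have hk0pos : 0 < k 0 := by
        have : (0 : ℝ) < k 0 := (by positivity : 0 < s / μ).trans_le m0.1
        exact_mod_cast this
      have hf : dualFlip k = ![k 0, k 1, -k 2, -k 3] := by rw [dualFlip, if_pos hk0pos]
      rw [hf]
      refine ⟨s, m, hs, ?_, by simpa using r1, by simpa using r2, by simpa using r3⟩
      intro i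
      fin_cases i
      · simpa using m0
      · simpa using m1
      · simpa using m2
      · simpa using m3
    · rw [abs_of_nonpos hs0] at hs
      obtain ⟨m, m0, m1, m2, m3, r1, r2, r3⟩ := hdual c hc hcc M r hM hrM hr1 a0 ha0 a1 ha1 a2 ha2 ha
        (-s) (-t1) (-t2) (-w) (by linarith) hs (by rwa [abs_neg]) (by rwa [abs_neg])
        (by rwa [abs_neg]) (-k 0) (-k 1) (k 2) (k 3) (by push_cast; linarith)
        (by push_cast; linarith) (by linarith) (by linarith) (by simpa using hneg')
      have hspos : 0 < -s := (inv_pos.2 hμ0).trans_le m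
      have hk0pos : ¬ 0 < k 0 := by
        have : (0 : ℝ) < (-k 0 : ℤ) := (by positivity : 0 < -s / μ).trans_le m0.1
        have : 0 < - k 0 := by exact_mod_cast this
        linarith
      have hf : dualFlip k = ![-k 0, -k 1, k 2, k 3] := by rw [dualFlip, if_neg hk0pos]
      rw [hf]
      refine ⟨-s, m, hs, ?_, by simpa using r1, by simpa using r2, by simpa using r3⟩
      intro i
      fin_cases i
      · simpa using m0
      · simpa using m1
      · simpa using m2
      · simpa using m3
  obtain ⟨s, hsμ, hsK, hl, hsurf, hr2, hr3⟩ := main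
  have hs0 : 0 < s := (inv_pos.2 hμ0).trans_le hsμ
  have hl3pos : (0 : ℝ) < dualFlip k 3 := (by positivity : 0 < s / μ).trans_le (hl 3).1
  have hl3 : 0 < dualFlip k 3 := by exact_mod_cast hl3pos
  have hcast : (((dualFlip k 3).toNat : ℕ) : ℝ) = dualFlip k 3 := by
    exact_mod_cast Int.toNat_of_nonneg hl3.le
  have hne : (dualFlip k 3).toNat ≠ 0 := by omega
  set L : ℝ := 2 ^ dualScale k with hL
  have hL0 : 0 < L := by positivity
  have hLle : L ≤ dualFlip k 3 := by
    rw [← hcast, hL]; exact_mod_cast Nat.pow_log_le_self 2 hne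
  have hLlt : (dualFlip k 3 : ℝ) ≤ 2 * L := by
    rw [← hcast, hL, ← pow_succ']
    exact_mod_cast (Nat.lt_pow_succ_log_self (by norm_num) _).le
  have hs1 : s ≤ 2 * μ * L := by
    have := (hl 3).1
    rw [div_le_iff₀ hμ0] at this
    nlinarith
  have hs2 : L ≤ μ * s := hLle.trans (hl 3).2
  refine ⟨⟨fun i => ⟨?_, ?_⟩, ?_⟩, ?_, hr2.trans ?_, hr3.trans ?_⟩
  · refine le_trans ?_ (hl i).1
    rw [div_le_div_iff₀ (by positivity) hμ0]
    nlinarith [mul_le_mul_of_nonneg_left hs2 hμ0.le, mul_pos (pow_pos hμ0 2) hs0]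
  · refine (hl i).2.trans ?_
    nlinarith
  · refine hsurf.trans ?_
    have h1 : s / L ∈ Icc (2 * μ)⁻¹ (2 * μ) := by
      constructor
      · rw [le_div_iff₀ hL0, inv_mul_le_iff₀ (by positivity)]; nlinarith
      · rwa [div_le_iff₀ hL0]
    have h2 := (le_abs_self _).trans (hB _ h1)
    rw [Real.div_rpow hs0.le hL0.le, div_le_iff₀ (Real.rpow_pos_of_pos hL0 _)] at h2
    calc C * s ^ (β - 2) ≤ C * (B * L ^ (β - 2)) := mul_le_mul_of_nonneg_left h2 hC0
      _ = _ := by rw [Real.rpow_sub hL0, Real.rpow_two]; field_simp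
  · have h1 : s ≤ 1 / (r ^ 2 * M) := hsK.trans (by gcongr; linarith)
    calc L ≤ μ * s := hs2
      _ ≤ 2 * μ ^ 2 * s := by
        refine mul_le_mul_of_nonneg_right ?_ hs0.le
        nlinarith
      _ ≤ _ := by gcongr
  all_goals
    rw [div_le_div_iff₀ (by positivity) (by positivity)]
    calc C * (r * M * L) ≤ C * (r * M * (μ * s)) := by gcongr
      _ = _ := by ring

/-! ### Counting dual points over all caps -/

/-- The geometric sum is dominated by its largest term because `ξ > 0`, so summing over dyadic
scales of dual points costs no logarithm. -/
lemma exists_sum_dyadic_rpow_le (ξ : ℝ) (hξ : 0 < ξ) :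
    ∃ C, 0 ≤ C ∧ ∀ (S : Finset ℕ) (B : ℝ), 0 ≤ B → (∀ m ∈ S, (2 : ℝ) ^ m ≤ B) →
      ∑ m ∈ S, ((2 : ℝ) ^ m) ^ ξ ≤ C * B ^ ξ := by
  set q : ℝ := 2 ^ ξ with hq
  have hq1 : 1 < q := Real.one_lt_rpow (by norm_num) hξ
  have hpow : ∀ m : ℕ, ((2 : ℝ) ^ m) ^ ξ = q ^ m := fun m => by
    rw [hq, ← Real.rpow_natCast, ← Real.rpow_natCast, ← Real.rpow_mul (by norm_num),
      ← Real.rpow_mul (by norm_num), mul_comm]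
  have hq0 : 0 < q - 1 := by linarith
  refine ⟨q / (q - 1), by positivity, fun S B hB hS => ?_⟩
  rcases S.eq_empty_or_nonempty with rfl | hne
  · simp only [Finset.sum_empty]
    have := Real.rpow_nonneg hB ξ
    positivity
  set n := S.max' hne
  have hn : (2 : ℝ) ^ n ≤ B := hS n (S.max'_mem hne)
  have hsub : S ⊆ Finset.range (n + 1) := fun m hm =>
    Finset.mem_range.2 (Nat.lt_succ_of_le (S.le_max' m hm))
  calc ∑ m ∈ S, ((2 : ℝ) ^ m) ^ ξ = ∑ m ∈ S, q ^ m := Finset.sum_congr rfl fun m _ => hpow m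
    _ ≤ ∑ m ∈ Finset.range (n + 1), q ^ m :=
      Finset.sum_le_sum_of_subset_of_nonneg hsub fun m _ _ => by positivity
    _ = (q ^ (n + 1) - 1) / (q - 1) := geom_sum_eq hq1.ne' _
    _ ≤ q ^ (n + 1) / (q - 1) := by gcongr; linarith
    _ = q / (q - 1) * ((2 : ℝ) ^ n) ^ ξ := by rw [hpow]; ring
    _ ≤ _ := by
      refine mul_le_mul_of_nonneg_left (Real.rpow_le_rpow (by positivity) hn hξ.le) (by positivity)

lemma card_Icc_floor_le (a b : ℝ) (h : a ≤ b) :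
    ((Finset.Icc ⌊a⌋ ⌊b⌋).card : ℝ) ≤ b - a + 2 := by
  have h1 : ⌊a⌋ ≤ ⌊b⌋ := Int.floor_mono h
  rw [Int.card_Icc]
  have h2 : (((⌊b⌋ + 1 - ⌊a⌋).toNat : ℕ) : ℝ) = ((⌊b⌋ + 1 - ⌊a⌋ : ℤ) : ℝ) := by
    exact_mod_cast Int.toNat_of_nonneg (by omega)
  rw [h2]
  push_cast
  linarith [Int.floor_le b, Int.lt_floor_add_one a]

/-- The integers `⌊a / r⌋` with `|a - v| ≤ δ` lie in this interval. -/
lemma floor_mem_of_abs_sub_le {a v δ r : ℝ} (hr : 0 < r) (h : |a - v| ≤ δ) :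
    ⌊a / r⌋ ∈ Finset.Icc ⌊(v - δ) / r⌋ ⌊(v + δ) / r⌋ := by
  rw [abs_le] at h
  rw [Finset.mem_Icc]
  exact ⟨Int.floor_mono (by gcongr; linarith), Int.floor_mono (by gcongr; linarith)⟩

open Classical in
/-- The nonzero dual points of a system of `r`-separated caps, counted with multiplicity. -/
lemma exists_sum_capDual_le (τ lam A ξ : ℝ) (hτ : 1 < τ) (hlam : 1 ≤ lam) (hA : 0 ≤ A) (hξ : 0 < ξ)
    (hβ : NearSolutionBound (τ / (τ - 1)) ξ) :
    ∃ c0, 0 < c0 ∧ ∀ c, 0 < c → c ≤ c0 → ∃ C, 0 ≤ C ∧ ∀ M r, 1 ≤ M → 1 ≤ r * M → r ≤ 1 →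
      ∀ (I : Finset (ℤ × ℤ)) (a0 a1 a2 : ℤ × ℤ → ℝ) (Z : ℤ × ℤ → Finset (Fin 4 → ℤ)),
      (∀ i ∈ I, a0 i ∈ Icc lam⁻¹ lam ∧ a1 i ∈ Icc lam⁻¹ lam ∧ a2 i ∈ Icc lam⁻¹ lam ∧
        |a0 i ^ τ + a1 i ^ τ - a2 i ^ τ - 1| ≤ A * r ^ 2 ∧ i = (⌊a0 i / r⌋, ⌊a1 i / r⌋)) →
      (∀ i ∈ I, ∀ k ∈ Z i, k ≠ 0 ∧ CapDual τ c M r (a0 i) (a1 i) (a2 i) k) →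
      (∑ i ∈ I, ((Z i).card : ℝ)) ≤ C * (1 / (r ^ 2 * M)) ^ (2 + ξ) := by
  obtain ⟨c0, lam', A', E, hc0, -, hlam', hA', hE, hspec⟩ := exists_capDual_spec τ lam A hτ hlam hA
  obtain ⟨Cβ, hCβ, hcount⟩ := hβ lam' A' hlam' hA'
  obtain ⟨G, hG, hgeom⟩ := exists_sum_dyadic_rpow_le ξ hξ
  refine ⟨c0, hc0, fun c hc hcc => ?_⟩
  set H := 2 * E + 2 * lam' with hH
  have hH0 : 0 ≤ H := by positivity
  refine ⟨2 * H ^ 2 * Cβ * (G * lam' ^ ξ), by positivity, ?_⟩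
  intro M r hM hrM hr1 I a0 a1 a2 Z hI hZ
  have hM0 : 0 < M := by linarith
  have hr0 : 0 < r := by
    by_contra h; push Not at h
    linarith [mul_nonpos_of_nonpos_of_nonneg h hM0.le]
  set K := 1 / (r ^ 2 * M) with hK
  have hK0 : 0 < K := by positivity
  set P : Finset (Σ _ : ℤ × ℤ, Fin 4 → ℤ) := I.sigma Z with hP
  have hPmem : ∀ q ∈ P, q.1 ∈ I ∧ q.2 ∈ Z q.1 := fun q hq => Finset.mem_sigma.1 hq
  have hsp : ∀ q ∈ P, _ := fun q hq =>
    hspec c hc hcc M r hM hrM hr1 _ (hI q.1 (hPmem q hq).1).1 _ (hI q.1 (hPmem q hq).1).2.1 _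
      (hI q.1 (hPmem q hq).1).2.2.1 (hI q.1 (hPmem q hq).1).2.2.2.1 q.2
      (hZ q.1 (hPmem q hq).1 q.2 (hPmem q hq).2).2 (hZ q.1 (hPmem q hq).1 q.2 (hPmem q hq).2).1
  have hcard : (∑ i ∈ I, ((Z i).card : ℝ)) = (P.card : ℝ) := by
    rw [hP, Finset.card_sigma]; push_cast; rfl
  rw [hcard]
  set S : Finset ℕ := P.image fun q => dualScale q.2 with hS
  have hPS : P.card = ∑ m ∈ S, (P.filter fun q => dualScale q.2 = m).card :=
    Finset.card_eq_sum_card_image _ _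
  have hSle : ∀ m ∈ S, (2 : ℝ) ^ m ≤ lam' * K := by
    intro m hm
    obtain ⟨q, hq, rfl⟩ := Finset.mem_image.1 hm
    exact (hsp q hq).2.1
  have hlevel : ∀ m ∈ S, ((P.filter fun q => dualScale q.2 = m).card : ℝ) ≤
      2 * H ^ 2 * Cβ * K ^ 2 * ((2 : ℝ) ^ m) ^ ξ := by
    intro m hm
    set L : ℝ := 2 ^ m with hL
    have hL1 : 1 ≤ L := one_le_pow₀ (by norm_num)
    have hL0 : 0 < L := by positivity
    have hLK := hSle m hm
    set Pm := P.filter fun q => dualScale q.2 = m with hPm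
    set Y := Pm.image fun q => dualFlip q.2 with hY
    have hYc : (Y.card : ℝ) ≤ Cβ * L ^ (2 + ξ) := by
      refine hcount L hL1 Y fun y hy => ?_
      obtain ⟨q, hq, rfl⟩ := Finset.mem_image.1 hy
      obtain ⟨hq1, hq2⟩ := Finset.mem_filter.1 hq
      have := (hsp q hq1).1
      rwa [hq2] at this
    set δ := E / (r * M * L) with hδ
    have hδ0 : 0 ≤ δ := by positivity
    -- The constant 2 left by rounding is absorbed because `L ≤ lam' * K`.
    have hδr : 2 * δ / r + 2 ≤ H * K / L := by
      have e1 : 2 * δ / r = 2 * E * K / L := by rw [hδ, hK]; field_simp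
      rw [e1, hH, add_mul, add_div]
      gcongr
      rw [le_div_iff₀ hL0]; linarith
    -- The flipped point determines the dual vector up to two sign patterns and pins each of `a0`,
    -- `a1` to within `δ`, leaving at most `H * K / L` values for each cap index.
    have hfib : ∀ y ∈ Y, ((Pm.filter fun q => dualFlip q.2 = y).card : ℝ) ≤
        2 * (H * K / L) ^ 2 := by
      intro y _
      set v0 := ((y 0 : ℝ) / y 3) ^ (τ - 1)⁻¹
      set v1 := ((y 1 : ℝ) / y 3) ^ (τ - 1)⁻¹
      set J0 := Finset.Icc ⌊(v0 - δ) / r⌋ ⌊(v0 + δ) / r⌋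
      set J1 := Finset.Icc ⌊(v1 - δ) / r⌋ ⌊(v1 + δ) / r⌋
      have hJ : ∀ v : ℝ, ((Finset.Icc ⌊(v - δ) / r⌋ ⌊(v + δ) / r⌋).card : ℝ) ≤ H * K / L := fun v =>
        (card_Icc_floor_le _ _ (by gcongr; linarith)).trans (by
          refine le_trans (le_of_eq ?_) hδr
          ring)
      set W : Finset (Fin 4 → ℤ) := {![y 0, y 1, -y 2, -y 3], ![-y 0, -y 1, y 2, y 3]}
      have hsubset : (Pm.filter fun q => dualFlip q.2 = y) ⊆
          ((J0 ×ˢ J1) ×ˢ W).image fun z => ⟨z.1, z.2⟩ := by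
        intro q hq
        obtain ⟨hq1, hqy⟩ := Finset.mem_filter.1 hq
        obtain ⟨hqP, hqm⟩ := Finset.mem_filter.1 hq1
        obtain ⟨-, -, h3, h4⟩ := hsp q hqP
        rw [hqm, hqy] at h3 h4
        have hi := (hI q.1 (hPmem q hqP).1).2.2.2.2
        refine Finset.mem_image.2 ⟨(q.1, q.2), ?_, rfl⟩
        rw [Finset.mem_product, Finset.mem_product]
        refine ⟨⟨?_, ?_⟩, ?_⟩
        · have := floor_mem_of_abs_sub_le hr0 h3
          have e := congrArg Prod.fst hi
          simp only at e ⊢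
          rw [e]; exact this
        · have := floor_mem_of_abs_sub_le hr0 h4
          have e := congrArg Prod.snd hi
          simp only at e ⊢
          rw [e]; exact this
        · rw [Finset.mem_insert, Finset.mem_singleton]
          exact eq_or_eq_of_dualFlip_eq hqy
      have h1 : (Pm.filter fun q => dualFlip q.2 = y).card ≤ J0.card * J1.card * 2 := by
        refine (Finset.card_le_card hsubset).trans (Finset.card_image_le.trans ?_)
        rw [Finset.card_product, Finset.card_product]
        exact Nat.mul_le_mul_left _ Finset.card_le_two
      calc ((Pm.filter fun q => dualFlip q.2 = y).card : ℝ) ≤ (J0.card * J1.card * 2 : ℕ) := by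
            exact_mod_cast h1
        _ = (J0.card : ℝ) * J1.card * 2 := by push_cast; ring
        _ ≤ (H * K / L) * (H * K / L) * 2 := by
          gcongr
          · exact hJ v0
          · exact hJ v1
        _ = _ := by ring
    have h2 : (Pm.card : ℝ) ≤ ∑ y ∈ Y, 2 * (H * K / L) ^ 2 := by
      rw [Finset.card_eq_sum_card_image (fun q => dualFlip q.2) Pm]
      push_cast
      exact Finset.sum_le_sum hfib
    rw [Finset.sum_const, nsmul_eq_mul] at h2
    refine h2.trans ((mul_le_mul_of_nonneg_right hYc (by positivity)).trans (le_of_eq ?_))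
    rw [Real.rpow_add hL0, Real.rpow_two]
    field_simp
  rw [hPS]
  push_cast
  calc _ ≤ ∑ m ∈ S, 2 * H ^ 2 * Cβ * K ^ 2 * ((2 : ℝ) ^ m) ^ ξ := Finset.sum_le_sum hlevel
    _ = 2 * H ^ 2 * Cβ * K ^ 2 * ∑ m ∈ S, ((2 : ℝ) ^ m) ^ ξ := by rw [Finset.mul_sum]
    _ ≤ 2 * H ^ 2 * Cβ * K ^ 2 * (G * (lam' * K) ^ ξ) := by
      refine mul_le_mul_of_nonneg_left (hgeom S _ (by positivity) hSle) (by positivity)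
    _ = _ := by
      rw [Real.mul_rpow (by positivity) hK0.le, Real.rpow_add hK0, Real.rpow_two]; ring

open Classical in
/-- The duality step: a bound for near solutions with exponent `τ / (τ - 1)` at the critical
precision gives a bound for exponent `τ` at every coarser precision. -/
theorem exists_card_nearSolution_le (τ ξ : ℝ) (hτ : 1 < τ) (hξ : 0 < ξ)
    (hβ : NearSolutionBound (τ / (τ - 1)) ξ) (lam A : ℝ) (hlam : 1 ≤ lam) (hA : 0 ≤ A) :
    ∃ C, 0 ≤ C ∧ ∀ M r, 1 ≤ M → 1 ≤ r * M → r ≤ 1 → ∀ X : Finset (Fin 4 → ℤ),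
      (∀ x ∈ X, NearSolution τ lam A M r x) →
      (X.card : ℝ) ≤ C * (r ^ 2 * M ^ 4 + r ^ 4 * M ^ 4 * (1 / (r ^ 2 * M)) ^ (2 + ξ)) := by
  have hlam0 : 0 < lam := by linarith
  obtain ⟨c1, hc1, hcap⟩ := exists_cap_card_le τ lam A hτ hlam hA
  obtain ⟨c0, hc0, hdual⟩ := exists_sum_capDual_le τ (lam ^ 2) (A * lam ^ τ) ξ hτ
    (one_le_pow₀ hlam) (by positivity) hξ hβ
  set c := min c0 c1 with hc
  have hcpos : 0 < c := lt_min hc0 hc1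
  obtain ⟨C1, hC1, hcap⟩ := hcap c hcpos (min_le_right _ _)
  obtain ⟨C2, hC2, hdual⟩ := hdual c hcpos (min_le_left _ _)
  refine ⟨C1 * ((lam ^ 2 + 2) ^ 2 + C2), by positivity, ?_⟩
  intro M r hM hrM hr1 X hX
  have hM0 : 0 < M := by linarith
  have hr0 : 0 < r := by
    by_contra h; push Not at h
    linarith [mul_nonpos_of_nonpos_of_nonneg h hM0.le]
  set K := 1 / (r ^ 2 * M) with hK
  have hK0 : 0 < K := by positivity
  let cell : (Fin 4 → ℤ) → ℤ × ℤ := fun x => (⌊(x 0 : ℝ) / x 3 / r⌋, ⌊(x 1 : ℝ) / x 3 / r⌋)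
  set I := X.image cell with hI
  have hrep : ∀ i ∈ I, ∃ p ∈ X, cell p = i := fun i hi => Finset.mem_image.1 hi
  -- Each occupied cell is centred at one of its own near solutions; the value 0 off `I` is never
  -- used.
  let rep : ℤ × ℤ → (Fin 4 → ℤ) := fun i => if h : ∃ p ∈ X, cell p = i then h.choose else 0
  have hrepX : ∀ i ∈ I, rep i ∈ X ∧ cell (rep i) = i := fun i hi => by
    have h := hrep i hi
    simp only [rep, dif_pos h]
    exact h.choose_spec
  let Z : ℤ × ℤ → Finset (Fin 4 → ℤ) := fun i =>
    (finite_dualBox (((rep i 0 : ℝ) / rep i 3) ^ (τ - 1)) (((rep i 1 : ℝ) / rep i 3) ^ (τ - 1))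
      (((rep i 2 : ℝ) / rep i 3) ^ (τ - 1)) (rep i 0 / rep i 3) (rep i 1 / rep i 3)
      (c / (r ^ 2 * M)) (c / (r * M)) (c / M)).toFinset
  have hZ : ∀ i k, k ∈ Z i ↔
      CapDual τ c M r (rep i 0 / rep i 3) (rep i 1 / rep i 3) (rep i 2 / rep i 3) k := fun i k => by
    simp only [Z, Finite.mem_toFinset, mem_ofPred_eq, CapDual]
  have hfib : ∀ i ∈ I, ((X.filter fun x => cell x = i).card : ℝ) ≤
      C1 * (r ^ 4 * M ^ 4) * (1 + ((Z i).erase 0).card) := by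
    intro i hi
    obtain ⟨hpX, hpc⟩ := hrepX i hi
    have h1 := hcap M r hM hr0 hr1 (rep i) (hX _ hpX) (X.filter fun x => cell x = i) (Z i) ?_
      fun k hk => (hZ i k).2 hk
    · refine h1.trans (mul_le_mul_of_nonneg_left ?_ (by positivity))
      -- The zero vector is set apart: summed over the caps it yields the main term `r ^ 2 * M ^ 4`,
      -- and only nonzero dual points go to the conjugate count.
      have h2 := Finset.pred_card_le_card_erase (s := Z i) (a := 0)
      have : (Z i).card ≤ ((Z i).erase 0).card + 1 := by omega
      have h' : ((Z i).card : ℝ) ≤ ((Z i).erase 0).card + 1 := by exact_mod_cast this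
      linarith
    · intro x hx
      obtain ⟨hxX, hxc⟩ := Finset.mem_filter.1 hx
      rw [← hpc] at hxc
      have key : ∀ {u v : ℝ}, ⌊u / r⌋ = ⌊v / r⌋ → |u - v| ≤ r := fun {u v} h => by
        have := (Int.abs_sub_lt_one_of_floor_eq_floor h).le
        rwa [← sub_div, abs_div, abs_of_pos hr0, div_le_one hr0] at this
      exact ⟨hX x hxX, key (congrArg Prod.fst hxc), key (congrArg Prod.snd hxc)⟩
  have hsum : (∑ i ∈ I, (((Z i).erase 0).card : ℝ)) ≤ C2 * K ^ (2 + ξ) := by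
    refine hdual M r hM hrM hr1 I (fun i => rep i 0 / rep i 3) (fun i => rep i 1 / rep i 3)
      (fun i => rep i 2 / rep i 3) (fun i => (Z i).erase 0) ?_ ?_
    · intro i hi
      obtain ⟨hpX, hpc⟩ := hrepX i hi
      have hp := hX _ hpX
      exact ⟨hp.ratio_mem hlam hM 0, hp.ratio_mem hlam hM 1, hp.ratio_mem hlam hM 2,
        hp.ratio_surface (by linarith) hlam hM hA, hpc.symm⟩
    · intro i hi k hk
      rw [Finset.mem_erase] at hk
      exact ⟨hk.1, (hZ i k).1 hk.2⟩
  have hIcard : (I.card : ℝ) ≤ (lam ^ 2 + 2) ^ 2 * (1 / r ^ 2) := by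
    have hsub : I ⊆ Finset.Icc ⌊(0 : ℝ)⌋ ⌊lam ^ 2 / r⌋ ×ˢ Finset.Icc ⌊(0 : ℝ)⌋ ⌊lam ^ 2 / r⌋ := by
      intro i hi
      obtain ⟨x, hx, rfl⟩ := Finset.mem_image.1 hi
      have hm : ∀ j, ⌊(x j : ℝ) / x 3 / r⌋ ∈ Finset.Icc ⌊(0 : ℝ)⌋ ⌊lam ^ 2 / r⌋ := fun j => by
        have h := (hX x hx).ratio_mem hlam hM j
        have h0 : (0 : ℝ) ≤ (x j : ℝ) / x 3 := le_trans (by positivity) h.1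
        rw [Finset.mem_Icc]
        exact ⟨Int.floor_mono (by positivity), Int.floor_mono (by gcongr; exact h.2)⟩
      exact Finset.mem_product.2 ⟨hm 0, hm 1⟩
    have h1 := card_Icc_floor_le 0 (lam ^ 2 / r) (by positivity)
    have h2 : lam ^ 2 / r - 0 + 2 ≤ (lam ^ 2 + 2) * (1 / r) := by
      rw [add_mul, mul_one_div, sub_zero]
      gcongr
      rw [mul_one_div, le_div_iff₀ hr0]; linarith
    have h3 := Finset.card_le_card hsub
    rw [Finset.card_product] at h3
    calc (I.card : ℝ) ≤ ((Finset.Icc ⌊(0 : ℝ)⌋ ⌊lam ^ 2 / r⌋).card : ℝ) *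
          (Finset.Icc ⌊(0 : ℝ)⌋ ⌊lam ^ 2 / r⌋).card := by exact_mod_cast h3
      _ ≤ ((lam ^ 2 + 2) * (1 / r)) * ((lam ^ 2 + 2) * (1 / r)) :=
        mul_le_mul (h1.trans h2) (h1.trans h2) (by positivity) (by positivity)
      _ = _ := by field_simp
  have hXcard : (X.card : ℝ) = ∑ i ∈ I, ((X.filter fun x => cell x = i).card : ℝ) := by
    rw [Finset.card_eq_sum_card_image cell X]; push_cast; rfl
  rw [hXcard]
  calc _ ≤ ∑ i ∈ I, C1 * (r ^ 4 * M ^ 4) * (1 + (((Z i).erase 0).card : ℝ)) :=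
        Finset.sum_le_sum hfib
    _ = C1 * (r ^ 4 * M ^ 4) * (I.card + ∑ i ∈ I, (((Z i).erase 0).card : ℝ)) := by
      rw [← Finset.mul_sum, Finset.sum_add_distrib]; simp
    _ ≤ C1 * (r ^ 4 * M ^ 4) * ((lam ^ 2 + 2) ^ 2 * (1 / r ^ 2) + C2 * K ^ (2 + ξ)) := by gcongr
    _ = C1 * (lam ^ 2 + 2) ^ 2 * (r ^ 2 * M ^ 4) +
        C1 * C2 * (r ^ 4 * M ^ 4 * K ^ (2 + ξ)) := by field_simp
    _ ≤ C1 * ((lam ^ 2 + 2) ^ 2 + C2) * (r ^ 2 * M ^ 4) +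
        C1 * ((lam ^ 2 + 2) ^ 2 + C2) * (r ^ 4 * M ^ 4 * K ^ (2 + ξ)) := by
      have h1 : 0 ≤ C1 * C2 * (r ^ 2 * M ^ 4) := by positivity
      have h2 : 0 ≤ C1 * (lam ^ 2 + 2) ^ 2 * (r ^ 4 * M ^ 4 * K ^ (2 + ξ)) := by positivity
      linarith
    _ = _ := by ring

/-! ### Bootstrapping the exponent -/

lemma NearSolution.mono {τ lam A M r r' : ℝ} {x : Fin 4 → ℤ} (hA : 0 ≤ A) (hM : 0 ≤ M)
    (hr : 0 ≤ r) (hrr : r ≤ r') (hx : NearSolution τ lam A M r x) :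
    NearSolution τ lam A M r' x := by
  have := Real.rpow_nonneg hM τ
  exact ⟨hx.1, hx.2.trans (by gcongr)⟩

lemma NearSolutionBound.mono {τ ξ ξ' : ℝ} (h : ξ ≤ ξ') (hb : NearSolutionBound τ ξ) :
    NearSolutionBound τ ξ' := by
  intro lam A hlam hA
  obtain ⟨C, hC, hX⟩ := hb lam A hlam hA
  refine ⟨C, hC, fun M hM X hx => (hX M hM X hx).trans ?_⟩
  exact mul_le_mul_of_nonneg_left (Real.rpow_le_rpow_of_exponent_le hM (by linarith)) hC

/-- Starting point of the iteration: count all quadruples in the box and ignore the equation. -/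
lemma nearSolutionBound_two (τ : ℝ) : NearSolutionBound τ 2 := by
  intro lam A hlam hA
  refine ⟨(lam + 2) ^ 4, by positivity, fun M hM X hX => ?_⟩
  have hsub : X ⊆ Fintype.piFinset fun _ : Fin 4 => Finset.Icc ⌊(0 : ℝ)⌋ ⌊lam * M⌋ := by
    intro x hx
    refine Fintype.mem_piFinset.2 fun i => Finset.mem_Icc.2 ⟨?_, ?_⟩
    · have := (hX x hx).pos hlam hM i
      simp only [Int.floor_zero]
      exact_mod_cast this.le
    · exact Int.le_floor.2 ((hX x hx).1 i).2
  have h1 := card_Icc_floor_le 0 (lam * M) (by positivity)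
  have h2 : lam * M - 0 + 2 ≤ (lam + 2) * M := by nlinarith
  have h3 := Finset.card_le_card hsub
  rw [Fintype.card_piFinset_const] at h3
  have h4 : (X.card : ℝ) ≤ ((Finset.Icc ⌊(0 : ℝ)⌋ ⌊lam * M⌋).card : ℝ) ^ 4 := by exact_mod_cast h3
  have h5 : M ^ ((2 : ℝ) + 2) = M ^ 4 := by
    rw [← Real.rpow_natCast]; norm_num
  rw [h5, ← mul_pow]
  exact h4.trans (pow_le_pow_left₀ (by positivity) (h1.trans h2) 4)

/-- Near solutions at precision `1 / M` are also near solutions at any coarser `r`, where the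
duality step applies. Enlarging `r` increases the main term and decreases the dual term, and the
gain comes from balancing them. -/
lemma nearSolutionBound_step {ξ : ℝ} (hξ : 0 < ξ) (hb : ∀ τ, 1 < τ → NearSolutionBound τ ξ)
    (τ : ℝ) (hτ : 1 < τ) : NearSolutionBound τ (ξ / (1 + ξ)) := by
  intro lam A hlam hA
  have hβ : 1 < τ / (τ - 1) := by rw [lt_div_iff₀ (by linarith)]; linarith
  obtain ⟨C, hC, hcard⟩ := exists_card_nearSolution_le τ ξ hτ hξ (hb _ hβ) lam A hlam hA
  refine ⟨C * 2, by positivity, fun M hM X hX => ?_⟩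
  have hM0 : 0 < M := by linarith
  set κ := ξ / (1 + ξ) with hκ
  have hκ0 : 0 < κ := by positivity
  have hκ1 : κ < 1 := by rw [hκ, div_lt_one (by positivity)]; linarith
  -- The two terms have exponents `2 + κ` and `2 + ξ - κ * ξ`; they agree exactly when `κ * (1 + ξ)
  -- = ξ`.
  set r := M ^ (-1 + κ / 2) with hr
  have hr0 : 0 < r := Real.rpow_pos_of_pos hM0 _
  have hr1 : r ≤ 1 := Real.rpow_le_one_of_one_le_of_nonpos hM (by linarith)
  have hMr : M⁻¹ ≤ r := by
    rw [hr, ← Real.rpow_neg_one]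
    exact Real.rpow_le_rpow_of_exponent_le hM (by linarith)
  have hrM : 1 ≤ r * M := by
    rw [inv_le_iff_one_le_mul₀ hM0] at hMr; linarith
  have h := hcard M r hM hrM hr1 X fun x hx => (hX x hx).mono hA hM0.le (by positivity) hMr
  have hpow : ∀ n : ℕ, M ^ n = M ^ (n : ℝ) := fun n => (Real.rpow_natCast M n).symm
  have hrpow : ∀ n : ℕ, r ^ n = M ^ ((-1 + κ / 2) * n) := fun n => by
    rw [hr, ← Real.rpow_natCast, ← Real.rpow_mul hM0.le]
  have e1 : r ^ 2 * M ^ 4 = M ^ (2 + κ) := by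
    rw [hrpow, hpow, ← Real.rpow_add hM0]; congr 1; push_cast; ring
  have e2 : 1 / (r ^ 2 * M) = M ^ (1 - κ) := by
    have : r ^ 2 * M = M ^ (-(1 - κ)) := by
      calc r ^ 2 * M = M ^ ((-1 + κ / 2) * (2 : ℕ)) * M ^ (1 : ℝ) := by rw [hrpow, Real.rpow_one]
        _ = _ := by rw [← Real.rpow_add hM0]; congr 1; push_cast; ring
    rw [this, Real.rpow_neg hM0.le, one_div, inv_inv]
  have e3 : r ^ 4 * M ^ 4 * (1 / (r ^ 2 * M)) ^ (2 + ξ) = M ^ (2 + κ) := by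
    rw [e2, hrpow, hpow, ← Real.rpow_mul hM0.le, ← Real.rpow_add hM0, ← Real.rpow_add hM0]
    congr 1
    have : κ * (1 + ξ) = ξ := by rw [hκ]; field_simp
    push_cast
    linarith
  rw [e1, e3] at h
  linarith

/-- For every `τ > 1` and `ξ > 0` there are `O(M ^ (2 + ξ))` near solutions at the critical
precision. -/
theorem nearSolutionBound_of_pos {τ ξ : ℝ} (hτ : 1 < τ) (hξ : 0 < ξ) : NearSolutionBound τ ξ := by
  -- All `τ > 1` are treated at once, since each step uses the conjugate exponent. The step adds 1
  -- to `1 / ξ`, so starting from `ξ = 2` it gives `1 / ξ = n + 1 / 2`.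
  have hind : ∀ n : ℕ, ∀ τ, 1 < τ → NearSolutionBound τ (2 / (2 * n + 1)) := by
    intro n
    induction n with
    | zero => intro τ _; simpa using nearSolutionBound_two τ
    | succ n ih =>
      intro τ hτ
      have h := nearSolutionBound_step (by positivity) ih τ hτ
      have e : (2 / (2 * (n : ℝ) + 1)) / (1 + 2 / (2 * n + 1)) = 2 / (2 * ((n + 1 : ℕ) : ℝ) + 1) := by
        push_cast
        field_simp
        ring
      rwa [e] at h
  obtain ⟨n, hn⟩ := exists_nat_gt (1 / ξ)
  refine (hind n τ hτ).mono ?_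
  rw [div_lt_iff₀ hξ] at hn
  rw [div_le_iff₀ (by positivity)]
  nlinarith

/-- The number of near solutions at an arbitrary precision `1 / M ≤ r ≤ 1`. -/
theorem exists_card_nearSolution_le_of_pos {τ ε : ℝ} (hτ : 1 < τ) (hε : 0 < ε) (lam A : ℝ)
    (hlam : 1 ≤ lam) (hA : 0 ≤ A) :
    ∃ C, 0 ≤ C ∧ ∀ M r, 1 ≤ M → 1 ≤ r * M → r ≤ 1 → ∀ X : Finset (Fin 4 → ℤ),
      (∀ x ∈ X, NearSolution τ lam A M r x) →
      (X.card : ℝ) ≤ C * (r ^ 2 * M ^ 4 + M ^ (2 + ε)) := by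
  have hβ : 1 < τ / (τ - 1) := by rw [lt_div_iff₀ (by linarith)]; linarith
  obtain ⟨C, hC, h⟩ := exists_card_nearSolution_le τ ε hτ hε (nearSolutionBound_of_pos hβ hε) lam A
    hlam hA
  refine ⟨C, hC, fun M r hM hrM hr1 X hX => (h M r hM hrM hr1 X hX).trans ?_⟩
  have hM0 : 0 < M := by linarith
  have hr0 : 0 < r := by
    by_contra h; push Not at h
    linarith [mul_nonpos_of_nonpos_of_nonneg h hM0.le]
  set K := 1 / (r ^ 2 * M) with hK
  have hK0 : 0 < K := by positivity
  have hKM : K ≤ M := by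
    rw [hK, div_le_iff₀ (by positivity)]
    calc (1 : ℝ) ≤ (r * M) ^ 2 := one_le_pow₀ hrM
      _ = _ := by ring
  -- The powers of `r` cancel, so with arbitrarily small `ε` the dual term is essentially `M ^ 2` at
  -- every precision.
  have e : r ^ 4 * M ^ 4 * K ^ (2 + ε) = M ^ 2 * K ^ ε := by
    rw [Real.rpow_add hK0, Real.rpow_two, hK]; field_simp
  rw [e, Real.rpow_add hM0, Real.rpow_two]
  have := Real.rpow_le_rpow hK0.le hKM hε.le
  gcongr

/-! ### Additive energy and fourth moments -/

/-- The number of solutions of `g a + g b = g c + g d` in `B`. -/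
def seqEnergy (g : ℕ → ℤ) (B : Finset ℕ) : ℕ :=
  (((B ×ˢ B) ×ˢ (B ×ˢ B)).filter fun q => g q.1.1 + g q.1.2 = g q.2.1 + g q.2.2).card

/-- Solutions supported on disjoint index sets are distinct. This superadditivity lets a whole
generation of dyadic subblocks cost no more than the block itself. -/
lemma seqEnergy_add_le (g : ℕ → ℤ) {B B1 B2 : Finset ℕ} (h1 : B1 ⊆ B) (h2 : B2 ⊆ B)
    (hd : Disjoint B1 B2) : seqEnergy g B1 + seqEnergy g B2 ≤ seqEnergy g B := by
  unfold seqEnergy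
  rw [← Finset.card_union_of_disjoint]
  · refine Finset.card_le_card (Finset.union_subset ?_ ?_) <;>
    · refine Finset.filter_subset_filter _ ?_
      gcongr
  · refine Finset.disjoint_left.2 fun q hq hq' => ?_
    simp only [Finset.mem_filter, Finset.mem_product] at hq hq'
    exact Finset.disjoint_left.1 hd hq.1.1.1 hq'.1.1.1

/-- The exponential sum of an integer sequence over a finite set of indices. -/
noncomputable def seqSum (g : ℕ → ℤ) (B : Finset ℕ) (x : ℝ) : ℂ := ∑ n ∈ B, unitChar (g n * x)

@[fun_prop]
lemma continuous_seqSum (g : ℕ → ℤ) (B : Finset ℕ) : Continuous (seqSum g B) := by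
  unfold seqSum; fun_prop

/-- Expand the square of the sum over pairs and integrate against its conjugate; orthogonality keeps
the pairs with equal sums. -/
lemma integral_norm_seqSum_pow_four (g : ℕ → ℤ) (B : Finset ℕ) :
    ∫ x in (0 : ℝ)..1, ‖seqSum g B x‖ ^ 4 = seqEnergy g B := by
  classical
  have h1 : ∀ x, ((‖seqSum g B x‖ ^ 4 : ℝ) : ℂ) = ∑ p ∈ B ×ˢ B, ∑ q ∈ B ×ˢ B,
      unitChar (((g p.1 + g p.2 - (g q.1 + g q.2) : ℤ) : ℝ) * x) := by
    intro x
    have h2 : ((‖seqSum g B x‖ ^ 4 : ℝ) : ℂ) =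
        (seqSum g B x * seqSum g B x) * (starRingEnd ℂ) (seqSum g B x * seqSum g B x) := by
      rw [Complex.mul_conj, Complex.normSq_eq_norm_sq, norm_mul]; push_cast; ring
    have h3 : seqSum g B x * seqSum g B x = ∑ p ∈ B ×ˢ B, unitChar ((g p.1 + g p.2) * x) := by
      rw [seqSum, Finset.sum_mul_sum, Finset.sum_product]
      refine Finset.sum_congr rfl fun a _ => Finset.sum_congr rfl fun b _ => ?_
      rw [← unitChar_add, add_mul]
    rw [h2, h3, map_sum, Finset.sum_mul_sum]
    refine Finset.sum_congr rfl fun p _ => Finset.sum_congr rfl fun q _ => ?_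
    rw [conj_unitChar, ← unitChar_add]
    congr 1
    push_cast; ring
  have hint : ∀ n : ℤ, IntervalIntegrable (fun x : ℝ => unitChar ((n : ℝ) * x)) volume 0 1 :=
    fun n => (by fun_prop : Continuous fun x : ℝ => unitChar ((n : ℝ) * x)).intervalIntegrable _ _
  have h2 : (∫ x in (0 : ℝ)..1, ((‖seqSum g B x‖ ^ 4 : ℝ) : ℂ)) = (seqEnergy g B : ℂ) := by
    simp_rw [h1]
    rw [intervalIntegral.integral_finsetSum fun p _ =>
      (Continuous.intervalIntegrable (by fun_prop) _ _)]
    simp_rw [intervalIntegral.integral_finsetSum (s := B ×ˢ B) fun q _ => hint _, integral_unitChar]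
    rw [seqEnergy, Finset.card_filter, Finset.sum_product (s := B ×ˢ B) (t := B ×ˢ B)]
    push_cast
    refine Finset.sum_congr rfl fun p _ => Finset.sum_congr rfl fun q _ => ?_
    simp only [sub_eq_zero]
  rw [intervalIntegral.integral_ofReal] at h2
  exact_mod_cast h2

/-! ### A Rademacher–Menshov majorant for partial sums -/

/-- The indices of the block of length `l` after `p`. -/
abbrev block (p l : ℕ) : Finset ℕ := Finset.Ioc p (p + l)

lemma seqSum_block_add (g : ℕ → ℤ) (p l m : ℕ) (x : ℝ) :
    seqSum g (block p (l + m)) x = seqSum g (block p l) x + seqSum g (block (p + l) m) x := by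
  unfold seqSum block
  rw [← Finset.sum_union, Finset.Ioc_union_Ioc_eq_Ioc (by omega) (by omega), add_assoc]
  exact Finset.disjoint_left.2 fun n h1 h2 => by
    rw [Finset.mem_Ioc] at h1 h2; omega

/-- The sum of the fourth powers of the sums over all dyadic subblocks of the block of length
`2 ^ j` after `p`. -/
noncomputable def dyadicFourth (g : ℕ → ℤ) : ℕ → ℕ → ℝ → ℝ
  | 0, p, x => ‖seqSum g (block p 1) x‖ ^ 4
  | j + 1, p, x => ‖seqSum g (block p (2 ^ (j + 1))) x‖ ^ 4 + dyadicFourth g j p x +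
      dyadicFourth g j (p + 2 ^ j) x

lemma dyadicFourth_nonneg (g : ℕ → ℤ) (j p : ℕ) (x : ℝ) : 0 ≤ dyadicFourth g j p x := by
  induction j generalizing p with
  | zero => unfold dyadicFourth; positivity
  | succ j ih =>
    unfold dyadicFourth
    have := ih p
    have := ih (p + 2 ^ j)
    positivity

@[fun_prop]
lemma continuous_dyadicFourth (g : ℕ → ℤ) (j p : ℕ) : Continuous (dyadicFourth g j p) := by
  induction j generalizing p with
  | zero =>
    change Continuous fun x => ‖seqSum g (block p 1) x‖ ^ 4
    fun_prop
  | succ j ih =>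
    have := ih p
    have := ih (p + 2 ^ j)
    change Continuous fun x => ‖seqSum g (block p (2 ^ (j + 1))) x‖ ^ 4 + dyadicFourth g j p x +
      dyadicFourth g j (p + 2 ^ j) x
    fun_prop

lemma norm_seqSum_pow_four_le_dyadicFourth (g : ℕ → ℤ) (j p : ℕ) (x : ℝ) :
    ‖seqSum g (block p (2 ^ j)) x‖ ^ 4 ≤ dyadicFourth g j p x := by
  cases j with
  | zero => simp [dyadicFourth]
  | succ j =>
    unfold dyadicFourth
    linarith [dyadicFourth_nonneg g j p x, dyadicFourth_nonneg g j (p + 2 ^ j) x]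

lemma le_rpow_fourth_of_pow_le {a b : ℝ} (ha : 0 ≤ a) (h : a ^ 4 ≤ b) : a ≤ b ^ (1 / 4 : ℝ) := by
  have h1 := Real.rpow_le_rpow (by positivity) h (by norm_num : (0 : ℝ) ≤ 1 / 4)
  rwa [← Real.rpow_natCast, ← Real.rpow_mul ha, show ((4 : ℕ) : ℝ) * (1 / 4) = 1 by norm_num,
    Real.rpow_one] at h1

/-- The Rademacher–Menshov inequality for partial sums of a dyadic block. -/
lemma norm_seqSum_block_le (g : ℕ → ℤ) (j p l : ℕ) (hl : l ≤ 2 ^ j) (x : ℝ) :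
    ‖seqSum g (block p l) x‖ ≤ (j + 1) * dyadicFourth g j p x ^ (1 / 4 : ℝ) := by
  induction j generalizing p l with
  | zero =>
    have hb := Real.rpow_nonneg (dyadicFourth_nonneg g 0 p x) (1 / 4 : ℝ)
    interval_cases l
    · have h0 : seqSum g (block p 0) x = 0 := by simp [seqSum, block]
      rw [h0, norm_zero]
      simpa using hb
    · simpa using le_rpow_fourth_of_pow_le (norm_nonneg _)
        (norm_seqSum_pow_four_le_dyadicFourth g 0 p x)
  | succ j ih =>
    have hW1 := dyadicFourth_nonneg g j p x
    have hW2 := dyadicFourth_nonneg g j (p + 2 ^ j) x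
    have hle1 : dyadicFourth g j p x ≤ dyadicFourth g (j + 1) p x := by
      conv_rhs => unfold dyadicFourth
      have : 0 ≤ ‖seqSum g (block p (2 ^ (j + 1))) x‖ ^ 4 := by positivity
      linarith
    have hle2 : dyadicFourth g j (p + 2 ^ j) x ≤ dyadicFourth g (j + 1) p x := by
      conv_rhs => unfold dyadicFourth
      have : 0 ≤ ‖seqSum g (block p (2 ^ (j + 1))) x‖ ^ 4 := by positivity
      linarith
    have hr1 := Real.rpow_le_rpow hW1 hle1 (by norm_num : (0 : ℝ) ≤ 1 / 4)
    have hr2 := Real.rpow_le_rpow hW2 hle2 (by norm_num : (0 : ℝ) ≤ 1 / 4)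
    have hj : (0 : ℝ) ≤ j + 1 := by positivity
    have hb := Real.rpow_nonneg (dyadicFourth_nonneg g (j + 1) p x) (1 / 4 : ℝ)
    push_cast
    rcases le_total l (2 ^ j) with h | h
    · have := mul_le_mul_of_nonneg_left hr1 hj
      linarith [ih p l h]
    -- The full left half is itself a dyadic block and costs one fourth root; the remainder is an
    -- initial segment of the right half and costs `j + 1` by induction.
    · obtain ⟨m, rfl⟩ := Nat.exists_eq_add_of_le h
      rw [seqSum_block_add]
      have hm : m ≤ 2 ^ j := by rw [pow_succ] at hl; omega
      have h1 := le_rpow_fourth_of_pow_le (norm_nonneg _)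
        (norm_seqSum_pow_four_le_dyadicFourth g j p x)
      have h2 := ih (p + 2 ^ j) m hm
      have := mul_le_mul_of_nonneg_left hr2 hj
      have h3 := norm_add_le (seqSum g (block p (2 ^ j)) x) (seqSum g (block (p + 2 ^ j) m) x)
      linarith

/-- Each of the `j + 1` generations of subblocks contributes at most the energy of the whole block,
by superadditivity. -/
lemma integral_dyadicFourth_le (g : ℕ → ℤ) (j p : ℕ) :
    ∫ x in (0 : ℝ)..1, dyadicFourth g j p x ≤ (j + 1) * seqEnergy g (block p (2 ^ j)) := by
  induction j generalizing p with
  | zero => simp [dyadicFourth, integral_norm_seqSum_pow_four]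
  | succ j ih =>
    have hsplit : ∫ x in (0 : ℝ)..1, dyadicFourth g (j + 1) p x =
        (∫ x in (0 : ℝ)..1, ‖seqSum g (block p (2 ^ (j + 1))) x‖ ^ 4) +
        (∫ x in (0 : ℝ)..1, dyadicFourth g j p x) +
        ∫ x in (0 : ℝ)..1, dyadicFourth g j (p + 2 ^ j) x := by
      rw [← intervalIntegral.integral_add, ← intervalIntegral.integral_add]
      · rfl
      all_goals exact Continuous.intervalIntegrable (by fun_prop) _ _
    have hE : (seqEnergy g (block p (2 ^ j)) : ℝ) + seqEnergy g (block (p + 2 ^ j) (2 ^ j)) ≤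
        seqEnergy g (block p (2 ^ (j + 1))) := by
      have : 2 ^ (j + 1) = 2 ^ j + 2 ^ j := by ring
      have hp : 0 < 2 ^ j := by positivity
      exact_mod_cast seqEnergy_add_le g (Finset.Ioc_subset_Ioc (by omega) (by omega))
        (Finset.Ioc_subset_Ioc (Nat.le_add_right _ _) (by omega))
        (Finset.disjoint_left.2 fun n h1 h2 => by rw [Finset.mem_Ioc] at h1 h2; omega)
    rw [hsplit, integral_norm_seqSum_pow_four]
    have hj : (0 : ℝ) ≤ j + 1 := by positivity
    have := mul_le_mul_of_nonneg_left hE hj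
    push_cast
    linarith [ih p, ih (p + 2 ^ j)]

/-- A majorant for the fourth powers of all sums over `1, …, N` with `N ≤ 2 ^ k`. -/
noncomputable def fourthMajorant (g : ℕ → ℤ) (k : ℕ) (x : ℝ) : ℝ :=
  1 + ∑ i ∈ Finset.range k, dyadicFourth g i (2 ^ i) x

@[fun_prop]
lemma continuous_fourthMajorant (g : ℕ → ℤ) (k : ℕ) : Continuous (fourthMajorant g k) := by
  unfold fourthMajorant; fun_prop

lemma one_le_fourthMajorant (g : ℕ → ℤ) (k : ℕ) (x : ℝ) : 1 ≤ fourthMajorant g k x := by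
  unfold fourthMajorant
  linarith [Finset.sum_nonneg fun i (_ : i ∈ Finset.range k) => dyadicFourth_nonneg g i (2 ^ i) x]

/-- Split `1, …, N` into the point 1, paid for by the summand 1 of the majorant, full blocks `(2^i,
2^(i+1)]`, and an initial segment of one more such block. The last doubling costs at most `k + 1`
fourth roots, and `(k + 1)^2 + (k + 1) ≤ (k + 2)^2`. -/
lemma norm_seqSum_le_fourthMajorant (g : ℕ → ℤ) (k N : ℕ) (hN : N ≤ 2 ^ k) (x : ℝ) :
    ‖seqSum g (block 0 N) x‖ ≤ (k + 1) ^ 2 * fourthMajorant g k x ^ (1 / 4 : ℝ) := by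
  induction k generalizing N with
  | zero =>
    have hU : fourthMajorant g 0 x = 1 := by simp [fourthMajorant]
    rw [hU]
    rw [pow_zero] at hN
    interval_cases N
    · simp [seqSum, block]
    · simp [seqSum, block, norm_unitChar]
  | succ k ih =>
    have hU : fourthMajorant g (k + 1) x = fourthMajorant g k x + dyadicFourth g k (2 ^ k) x := by
      unfold fourthMajorant; rw [Finset.sum_range_succ, add_assoc]
    have hW := dyadicFourth_nonneg g k (2 ^ k) x
    have hU1 := one_le_fourthMajorant g k x
    have hr1 := Real.rpow_le_rpow (by linarith) (by linarith :
      fourthMajorant g k x ≤ fourthMajorant g (k + 1) x) (by norm_num : (0 : ℝ) ≤ 1 / 4)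
    have hr2 := Real.rpow_le_rpow hW (by linarith :
      dyadicFourth g k (2 ^ k) x ≤ fourthMajorant g (k + 1) x) (by norm_num : (0 : ℝ) ≤ 1 / 4)
    have hb : 0 ≤ fourthMajorant g (k + 1) x ^ (1 / 4 : ℝ) :=
      Real.rpow_nonneg (by linarith) _
    have hk : (0 : ℝ) ≤ k := by positivity
    have hr1' := mul_le_mul_of_nonneg_left hr1 (by positivity : (0 : ℝ) ≤ (k + 1) ^ 2)
    have hr2' := mul_le_mul_of_nonneg_left hr2 (by positivity : (0 : ℝ) ≤ k + 1)
    push_cast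
    rcases le_total N (2 ^ k) with h | h
    · have := ih N h
      nlinarith
    · obtain ⟨m, rfl⟩ := Nat.exists_eq_add_of_le h
      rw [seqSum_block_add, zero_add]
      have hm : m ≤ 2 ^ k := by rw [pow_succ] at hN; omega
      have h1 := ih (2 ^ k) le_rfl
      have h2 := norm_seqSum_block_le g k (2 ^ k) m hm x
      have h3 := norm_add_le (seqSum g (block 0 (2 ^ k)) x) (seqSum g (block (2 ^ k) m) x)
      have h4 : 0 ≤ (k + 2 : ℝ) * fourthMajorant g (k + 1) x ^ (1 / 4 : ℝ) := by positivity
      nlinarith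

lemma integral_fourthMajorant_le (g : ℕ → ℤ) (k : ℕ) :
    ∫ x in (0 : ℝ)..1, fourthMajorant g k x ≤
      1 + ∑ i ∈ Finset.range k, ((i : ℝ) + 1) * seqEnergy g (block (2 ^ i) (2 ^ i)) := by
  unfold fourthMajorant
  rw [intervalIntegral.integral_add (by simp)
    (Continuous.intervalIntegrable (by fun_prop) _ _),
    intervalIntegral.integral_finsetSum fun i _ => Continuous.intervalIntegrable (by fun_prop) _ _]
  simp only [intervalIntegral.integral_const, sub_zero, one_smul]
  gcongr with i hi
  exact integral_dyadicFourth_le g i (2 ^ i)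

/-! ### Energy of the Piatetski-Shapiro sequence -/

/-- The integer sequence `n ↦ ⌊n ^ τ⌋`. -/
noncomputable def floorPow (τ : ℝ) (n : ℕ) : ℤ := ⌊(n : ℝ) ^ τ⌋

/-- Three of the four indices determine the value at the last one, hence the index itself by
injectivity. -/
lemma seqEnergy_le_pow_three (g : ℕ → ℤ) (B : Finset ℕ) (hg : Function.Injective g) :
    seqEnergy g B ≤ B.card ^ 3 := by
  have h : seqEnergy g B ≤ ((B ×ˢ B) ×ˢ B).card := by
    refine Finset.card_le_card_of_injOn (fun q => (q.1, q.2.1)) ?_ ?_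
    · intro q hq
      simp only [Finset.coe_filter, Finset.mem_product, mem_ofPred_eq] at hq
      simp only [Finset.coe_product, mem_prod, Finset.mem_coe]
      exact ⟨hq.1.1, hq.1.2.1⟩
    · rintro ⟨⟨a, b⟩, c, d⟩ hq ⟨⟨a', b'⟩, c', d'⟩ hq' he
      simp only [Finset.coe_filter, mem_ofPred_eq] at hq hq'
      simp only [Prod.mk.injEq] at he ⊢
      obtain ⟨⟨rfl, rfl⟩, rfl⟩ := he
      refine ⟨⟨rfl, rfl⟩, rfl, hg ?_⟩
      linarith [hq.2, hq'.2]
  refine h.trans (le_of_eq ?_)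
  rw [Finset.card_product, Finset.card_product]; ring

/-- The number of solutions of `⌊a ^ τ⌋ + ⌊b ^ τ⌋ = ⌊c ^ τ⌋ + ⌊d ^ τ⌋` in a dyadic block. -/
theorem exists_seqEnergy_floorPow_le {τ e ε : ℝ} (hτ : 1 ≤ τ) (he : 2 ≤ e) (heτ : 4 - τ ≤ e)
    (hε : 0 < ε) :
    ∃ C, 0 ≤ C ∧ ∀ i : ℕ, (seqEnergy (floorPow τ) (block (2 ^ i) (2 ^ i)) : ℝ) ≤
      C * ((2 : ℝ) ^ i) ^ (e + ε) := by
  rcases hτ.eq_or_lt with rfl | hτ1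
  -- At `τ = 1` there is no conjugate exponent, but then `e ≥ 3` and the trivial cubic bound
  -- suffices.
  · refine ⟨1, zero_le_one, fun i => ?_⟩
    have hinj : Function.Injective (floorPow 1) := fun a b h => by
      simpa [floorPow] using h
    have h := seqEnergy_le_pow_three (floorPow 1) (block (2 ^ i) (2 ^ i)) hinj
    have hc : (block (2 ^ i) (2 ^ i)).card = 2 ^ i := by simp [block]
    rw [hc] at h
    have h1 : (seqEnergy (floorPow 1) (block (2 ^ i) (2 ^ i)) : ℝ) ≤ ((2 : ℝ) ^ i) ^ 3 := by
      exact_mod_cast h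
    rw [one_mul]
    refine h1.trans ?_
    rw [← Real.rpow_natCast ((2 : ℝ) ^ i)]
    exact Real.rpow_le_rpow_of_exponent_le (one_le_pow₀ (by norm_num)) (by push_cast; linarith)
  · obtain ⟨C, hC, hcard⟩ := exists_card_nearSolution_le_of_pos hτ1 hε 2 2 (by norm_num)
      (by norm_num)
    refine ⟨2 * C, by positivity, fun i => ?_⟩
    set M : ℝ := 2 ^ i with hM
    have hM1 : 1 ≤ M := one_le_pow₀ (by norm_num)
    have hM0 : 0 < M := by linarith
    -- With `r = M ^ (-η / 2)`, the bound `η ≤ 2` gives `1 ≤ r * M`, and `η ≤ τ` gives `1 ≤ r ^ 2 *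
    -- M ^ τ`, so the tolerance exceeds the rounding error of the floors. The main term is then `M ^
    -- (4 - η)`.
    set η := min τ 2 with hη
    have hη1 : 1 < η := lt_min hτ1 (by norm_num)
    have hη2 : η ≤ 2 := min_le_right _ _
    have hητ : η ≤ τ := min_le_left _ _
    have hηe : 4 - η ≤ e := by
      rcases min_choice τ 2 with h | h <;> rw [hη, h] <;> linarith
    set r := M ^ (-(η / 2)) with hr
    have hr0 : 0 < r := Real.rpow_pos_of_pos hM0 _
    have hr1 : r ≤ 1 := Real.rpow_le_one_of_one_le_of_nonpos hM1 (by linarith)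
    have hrM : 1 ≤ r * M := by
      calc (1 : ℝ) ≤ M ^ (-(η / 2) + 1) := Real.one_le_rpow hM1 (by linarith)
        _ = _ := by rw [Real.rpow_add_one hM0.ne']
    have hr2 : r ^ 2 = M ^ (-η) := by
      rw [hr, ← Real.rpow_natCast, ← Real.rpow_mul hM0.le]; congr 1; push_cast; ring
    let vec : (ℕ × ℕ) × (ℕ × ℕ) → Fin 4 → ℤ := fun q => ![q.1.1, q.1.2, q.2.1, q.2.2]
    have hvec : Function.Injective vec := by
      rintro ⟨⟨a, b⟩, c, d⟩ ⟨⟨a', b'⟩, c', d'⟩ h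
      have h0 := congrFun h 0
      have h1 := congrFun h 1
      have h2 := congrFun h 2
      have h3 := congrFun h 3
      simp only [vec, Matrix.cons_val] at h0 h1 h2 h3
      simp only [Prod.mk.injEq]
      omega
    have hX := hcard M r hM1 hrM hr1
      ((((block (2 ^ i) (2 ^ i) ×ˢ block (2 ^ i) (2 ^ i)) ×ˢ
        (block (2 ^ i) (2 ^ i) ×ˢ block (2 ^ i) (2 ^ i))).filter fun q =>
        floorPow τ q.1.1 + floorPow τ q.1.2 = floorPow τ q.2.1 + floorPow τ q.2.2).image vec) ?_
    · rw [Finset.card_image_of_injective _ hvec] at hX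
      refine hX.trans ?_
      have e1 : r ^ 2 * M ^ 4 ≤ M ^ (e + ε) := by
        rw [hr2, ← Real.rpow_natCast M 4, ← Real.rpow_add hM0]
        exact Real.rpow_le_rpow_of_exponent_le hM1 (by push_cast; linarith)
      have e2 : M ^ (2 + ε) ≤ M ^ (e + ε) :=
        Real.rpow_le_rpow_of_exponent_le hM1 (by linarith)
      have := mul_le_mul_of_nonneg_left (add_le_add e1 e2) hC
      linarith
    · intro x hx
      obtain ⟨⟨⟨a, b⟩, c, d⟩, hq, rfl⟩ := Finset.mem_image.1 hx
      simp only [Finset.mem_filter, Finset.mem_product, Finset.mem_Ioc] at hq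
      obtain ⟨⟨⟨ha, hb⟩, hc, hd⟩, heq⟩ := hq
      have hrange : ∀ n : ℕ, (2 ^ i < n ∧ n ≤ 2 ^ i + 2 ^ i) → M / 2 ≤ ((n : ℤ) : ℝ) ∧
          ((n : ℤ) : ℝ) ≤ 2 * M := by
        rintro n ⟨h1, h2⟩
        have h1' : M < n := by rw [hM]; exact_mod_cast h1
        have h2' : (n : ℝ) ≤ M + M := by rw [hM]; exact_mod_cast h2
        push_cast
        constructor <;> linarith
      refine ⟨fun j => ?_, ?_⟩
      · fin_cases j
        · exact hrange a ha
        · exact hrange b hb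
        · exact hrange c hc
        · exact hrange d hd
      -- The four fractional parts, two with each sign, sum to at most 2 in absolute value.
      · have e1 : 2 ≤ 2 * r ^ 2 * M ^ τ := by
          rw [hr2, mul_assoc, ← Real.rpow_add hM0]
          have : 1 ≤ M ^ (-η + τ) := Real.one_le_rpow hM1 (by linarith)
          linarith
        refine le_trans ?_ e1
        have heq' : (floorPow τ a : ℝ) + floorPow τ b = floorPow τ c + floorPow τ d := by
          exact_mod_cast heq
        have hfl : ∀ n : ℕ, (floorPow τ n : ℝ) ≤ (n : ℝ) ^ τ ∧ (n : ℝ) ^ τ ≤ floorPow τ n + 1 :=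
          fun n => ⟨Int.floor_le _, (Int.lt_floor_add_one _).le⟩
        simp only [vec, Matrix.cons_val, Int.cast_natCast]
        rw [abs_le]
        constructor <;>
          linarith [(hfl a).1, (hfl a).2, (hfl b).1, (hfl b).2, (hfl c).1, (hfl c).2, (hfl d).1,
            (hfl d).2]

lemma exists_integral_fourthMajorant_le {τ e ε : ℝ} (hτ : 1 ≤ τ) (he : 2 ≤ e) (heτ : 4 - τ ≤ e)
    (hε : 0 < ε) :
    ∃ C, 0 ≤ C ∧ ∀ k : ℕ, ∫ x in (0 : ℝ)..1, fourthMajorant (floorPow τ) k x ≤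
      C * ((k : ℝ) + 1) ^ 2 * ((2 : ℝ) ^ k) ^ (e + ε) := by
  obtain ⟨C, hC, hE⟩ := exists_seqEnergy_floorPow_le hτ he heτ hε
  refine ⟨1 + C, by positivity, fun k => (integral_fourthMajorant_le _ k).trans ?_⟩
  set Q := ((2 : ℝ) ^ k) ^ (e + ε) with hQ
  have hQ1 : 1 ≤ Q := Real.one_le_rpow (one_le_pow₀ (by norm_num)) (by linarith)
  have hterm : ∀ i ∈ Finset.range k, ((i : ℝ) + 1) *
      seqEnergy (floorPow τ) (block (2 ^ i) (2 ^ i)) ≤ ((k : ℝ) + 1) * (C * Q) := by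
    intro i hi
    have hik : i ≤ k := (Finset.mem_range.1 hi).le
    have hik' : (i : ℝ) ≤ k := by exact_mod_cast hik
    have h1 : ((2 : ℝ) ^ i) ^ (e + ε) ≤ Q := by
      refine Real.rpow_le_rpow (by positivity) ?_ (by linarith)
      exact pow_le_pow_right₀ (by norm_num) hik
    refine mul_le_mul (by linarith) ((hE i).trans ?_) (by positivity) (by positivity)
    exact mul_le_mul_of_nonneg_left h1 hC
  have h := Finset.sum_le_sum hterm
  rw [Finset.sum_const, Finset.card_range, nsmul_eq_mul] at h
  have hk : (0 : ℝ) ≤ k := by positivity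
  have h2 : (1 : ℝ) ≤ ((k : ℝ) + 1) ^ 2 * Q := by
    have : (1 : ℝ) ≤ ((k : ℝ) + 1) ^ 2 := one_le_pow₀ (by linarith)
    nlinarith
  have h3 : (k : ℝ) * (((k : ℝ) + 1) * (C * Q)) ≤ ((k : ℝ) + 1) ^ 2 * (C * Q) := by
    rw [← mul_assoc]
    refine mul_le_mul_of_nonneg_right ?_ (by positivity)
    nlinarith
  calc _ ≤ ((k : ℝ) + 1) ^ 2 * Q + ((k : ℝ) + 1) ^ 2 * (C * Q) := by linarith
    _ = _ := by ring

/-! ### Lipschitz bound for the sums -/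

lemma norm_unitChar_sub_le (a b : ℝ) : ‖unitChar a - unitChar b‖ ≤ 2 * Real.pi * |a - b| := by
  have h : ∀ z : ℝ, unitChar z = Complex.exp (Complex.I * ((2 * Real.pi * z : ℝ) : ℂ)) := fun z => by
    unfold unitChar; congr 1; push_cast; ring
  have e : unitChar a - unitChar b = unitChar b * (unitChar (a - b) - 1) := by
    rw [mul_sub, ← unitChar_add]; simp
  rw [e, norm_mul, norm_unitChar, one_mul, h]
  refine (Real.norm_exp_I_mul_ofReal_sub_one_le).trans ?_
  rw [Real.norm_eq_abs, abs_mul, abs_of_pos (by positivity)]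

/-- There are `N` terms of frequency at most `N ^ τ`. The resulting Lipschitz constant `2π N ^ (1 +
τ)` dictates the cell width `N ^ (-(τ + 1 - α))` for a variation of order `N ^ α`. -/
lemma norm_seqSum_floorPow_sub_le {τ : ℝ} (hτ : 0 ≤ τ) (N : ℕ) (x y : ℝ) :
    ‖seqSum (floorPow τ) (block 0 N) x - seqSum (floorPow τ) (block 0 N) y‖ ≤
      2 * Real.pi * |x - y| * (N * (N : ℝ) ^ τ) := by
  unfold seqSum
  rw [← Finset.sum_sub_distrib]
  have hterm : ∀ n ∈ block 0 N, ‖unitChar (floorPow τ n * x) - unitChar (floorPow τ n * y)‖ ≤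
      2 * Real.pi * |x - y| * (N : ℝ) ^ τ := by
    intro n hn
    refine (norm_unitChar_sub_le _ _).trans ?_
    have hn' : (n : ℝ) ≤ N := by
      rw [Finset.mem_Ioc] at hn
      have : n ≤ N := by omega
      exact_mod_cast this
    have h0 : (0 : ℝ) ≤ floorPow τ n := by
      have : 0 ≤ floorPow τ n := Int.floor_nonneg.2 (by positivity)
      exact_mod_cast this
    have h1 : (floorPow τ n : ℝ) ≤ (N : ℝ) ^ τ :=
      (Int.floor_le _).trans (Real.rpow_le_rpow (by positivity) hn' hτ)
    rw [← mul_sub, abs_mul, abs_of_nonneg h0, mul_assoc (2 * Real.pi), mul_comm |x - y|]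
    gcongr
  refine (norm_sum_le_of_le _ hterm).trans (le_of_eq ?_)
  rw [Finset.sum_const, nsmul_eq_mul]
  simp [block]
  ring

lemma expSum_piatetskiShapiro (τ x : ℝ) (N : ℕ) :
    expSum (piatetskiShapiro τ) x N = seqSum (floorPow τ) (block 0 N) x := by
  unfold expSum seqSum block unitChar piatetskiShapiro floorPow
  rw [zero_add]
  refine Finset.sum_congr ?_ fun n _ => by rw [mul_comm x]
  ext n; simp only [Finset.mem_Icc, Finset.mem_Ioc]; omega

/-! ### Covering the large-sum set -/

open Filter Topology in
/-- Sets covered infinitely often by a system of small sets with finite total `s`-cost have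
vanishing `s`-dimensional Hausdorff measure. -/
lemma hausdorffMeasure_eq_zero_of_tsum_ne_top {X : Type*} [EMetricSpace X] [MeasurableSpace X]
    [BorelSpace X] (F : Set X) {s : ℝ} (hs : 0 ≤ s) (T : ℕ → Finset ℕ) (t : ℕ → ℕ → Set X)
    (ρ : ℕ → ENNReal) (hρ : Antitone ρ) (hρ0 : Tendsto ρ atTop (𝓝 0))
    (ht : ∀ k, ∀ m ∈ T k, Metric.ediam (t k m) ≤ ρ k)
    (hsum : ∑' k, ((T k).card : ENNReal) * ρ k ^ s ≠ ⊤)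
    (hF : ∀ x ∈ F, ∀ n, ∃ k, n ≤ k ∧ ∃ m ∈ T k, x ∈ t k m) :
    Measure.hausdorffMeasure s F = 0 := by
  -- For each `n` the cover uses only the levels from `n` on, so its cost is a tail of a convergent
  -- series.
  let ι : ℕ → Type := fun n => Σ k : ℕ, {m // m ∈ T (k + n)}
  have h := Measure.hausdorffMeasure_le_liminf_tsum (ι := ι) s F (l := atTop) ρ hρ0
    (fun n i => t (i.1 + n) i.2.1)
    (Eventually.of_forall fun n i => (ht _ _ i.2.2).trans (hρ (Nat.le_add_left _ _)))
    (Eventually.of_forall fun n x hx => by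
      obtain ⟨k, hk, m, hm, hxm⟩ := hF x hx n
      obtain ⟨j, rfl⟩ := Nat.exists_eq_add_of_le' hk
      exact mem_iUnion.2 ⟨⟨j, ⟨m, hm⟩⟩, hxm⟩)
  refine le_antisymm (h.trans ?_) zero_le
  have hle : ∀ n, ∑' i : ι n, Metric.ediam (t (i.1 + n) i.2.1) ^ s ≤
      ∑' k, ((T (k + n)).card : ENNReal) * ρ (k + n) ^ s := by
    intro n
    refine (ENNReal.tsum_sigma fun (k : ℕ) (m : {m // m ∈ T (k + n)}) =>
      Metric.ediam (t (k + n) m.1) ^ s).le.trans (ENNReal.tsum_le_tsum fun k => ?_)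
    rw [tsum_fintype]
    refine (Finset.sum_le_card_nsmul _ _ (ρ (k + n) ^ s) fun i _ => ?_).trans (le_of_eq ?_)
    · exact ENNReal.rpow_le_rpow (ht _ _ i.2) hs
    · rw [nsmul_eq_mul]; simp
  have hlim := ENNReal.tendsto_sum_nat_add (fun k => ((T k).card : ENNReal) * ρ k ^ s) hsum
  rw [← hlim.liminf_eq]
  exact liminf_le_liminf (Eventually.of_forall hle)

open Classical in
/-- The indices `m < q` such that `θ ≤ U` on the whole cell `[m / q, (m + 1) / q]`. -/
noncomputable def goodCells (U : ℝ → ℝ) (θ : ℝ) (q : ℕ) : Finset ℕ :=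
  (Finset.range q).filter fun m => ∀ y ∈ Icc ((m : ℝ) / q) ((m + 1) / q), θ ≤ U y

/-- Markov's inequality: each good cell carries at least `θ / q` of the integral, and the cells
overlap only at endpoints. -/
lemma card_goodCells_le {U : ℝ → ℝ} (hU : Continuous U) (hU0 : ∀ x, 0 ≤ U x) {θ : ℝ} (hθ : 0 < θ)
    {q : ℕ} (hq : 0 < q) :
    ((goodCells U θ q).card : ℝ) ≤ q * (∫ x in (0 : ℝ)..1, U x) / θ := by
  classical
  have hq0 : (0 : ℝ) < q := by exact_mod_cast hq
  have hint : ∀ a b : ℝ, IntervalIntegrable U volume a b := fun a b => hU.intervalIntegrable a b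
  have hsum : ∑ m ∈ Finset.range q, ∫ x in ((m : ℝ) / q)..((m + 1) / q), U x =
      ∫ x in (0 : ℝ)..1, U x := by
    have h := intervalIntegral.sum_integral_adjacent_intervals (f := U) (μ := volume)
      (a := fun m : ℕ => (m : ℝ) / q) (n := q) fun k _ => hint _ _
    simp only [Nat.cast_add, Nat.cast_one, Nat.cast_zero, zero_div, div_self hq0.ne'] at h
    exact h
  have hle : ∀ m : ℕ, (m : ℝ) / q ≤ (m + 1) / q := fun m => by gcongr; linarith
  have hcell : ∀ m ∈ goodCells U θ q, θ / q ≤ ∫ x in ((m : ℝ) / q)..((m + 1) / q), U x := by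
    intro m hm
    have hm' := (Finset.mem_filter.1 hm).2
    have h := intervalIntegral.integral_mono_on (hle m) intervalIntegrable_const (hint _ _) hm'
    rw [intervalIntegral.integral_const, smul_eq_mul] at h
    refine le_trans (le_of_eq ?_) h
    field_simp; ring
  have h1 : ((goodCells U θ q).card : ℝ) * (θ / q) ≤ ∫ x in (0 : ℝ)..1, U x := by
    rw [← hsum, ← nsmul_eq_mul]
    refine (Finset.card_nsmul_le_sum _ _ _ hcell).trans ?_
    exact Finset.sum_le_sum_of_subset_of_nonneg (Finset.filter_subset _ _) fun m _ _ =>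
      intervalIntegral.integral_nonneg (hle m) fun x _ => hU0 x
  rw [le_div_iff₀ hθ]
  have := mul_le_mul_of_nonneg_right h1 hq0.le
  have e : ((goodCells U θ q).card : ℝ) * (θ / q) * q = (goodCells U θ q).card * θ := by field_simp
  linarith

/-- The number of cells used to cover the set where some sum of length about `2 ^ k` is large. -/
noncomputable def cellCount (D : ℝ) (k : ℕ) : ℕ := ⌈4 * Real.pi * ((2 : ℝ) ^ k) ^ D⌉₊

lemma le_cellCount (D : ℝ) (k : ℕ) : 4 * Real.pi * ((2 : ℝ) ^ k) ^ D ≤ cellCount D k := Nat.le_ceil _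

lemma cellCount_pos (D : ℝ) (k : ℕ) : 0 < cellCount D k := by
  unfold cellCount
  have := Real.pi_pos
  rw [Nat.ceil_pos]; positivity

lemma cellCount_mono {D : ℝ} (hD : 0 ≤ D) : Monotone (cellCount D) := by
  intro a b hab
  unfold cellCount
  have := Real.pi_pos
  refine Nat.ceil_mono ?_
  gcongr
  norm_num

lemma cellCount_le {D : ℝ} (hD : 0 ≤ D) (k : ℕ) : (cellCount D k : ℝ) ≤ 17 * ((2 : ℝ) ^ k) ^ D := by
  -- The constant is 17 because `4π < 16`, and the unit lost to the ceiling is absorbed by a power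
  -- that is at least 1.
  have h1 : (1 : ℝ) ≤ ((2 : ℝ) ^ k) ^ D := Real.one_le_rpow (one_le_pow₀ (by norm_num)) hD
  have h2 := Real.pi_lt_four
  have h3 := (Nat.ceil_lt_add_one (a := 4 * Real.pi * ((2 : ℝ) ^ k) ^ D)
    (by have := Real.pi_pos; positivity)).le
  unfold cellCount
  nlinarith

/-- The level that the fourth power majorant reaches where some sum of length about `2 ^ k` is
large. -/
noncomputable def largeLevel (α : ℝ) (k : ℕ) : ℝ :=
  (((2 : ℝ) ^ k / 2) ^ α / (2 * ((k : ℝ) + 1) ^ 2)) ^ 4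

lemma largeLevel_pos (α : ℝ) (k : ℕ) : 0 < largeLevel α k := by
  unfold largeLevel; positivity

/-- The factor `4π` in `cellCount` makes the sum vary by at most `N ^ α / 2` on a cell. So one large
value keeps the sum above `N ^ α / 2` throughout, and the majorant passes this to the fourth power;
`N ≥ 2 ^ k / 2` makes the threshold depend only on `k`. -/
lemma mem_goodCells_of_large {τ α : ℝ} (hτ : 1 ≤ τ) (hα : 0 < α) (hα1 : α < 1) {k N : ℕ}
    (hN : 2 ^ k ≤ 2 * N) (hN' : N ≤ 2 ^ k) {x : ℝ}
    (hlarge : (N : ℝ) ^ α ≤ ‖seqSum (floorPow τ) (block 0 N) x‖) {m : ℕ}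
    (hm : m < cellCount (τ + 1 - α) k)
    (hxm : x ∈ Icc ((m : ℝ) / cellCount (τ + 1 - α) k) ((m + 1) / cellCount (τ + 1 - α) k)) :
    m ∈ goodCells (fourthMajorant (floorPow τ) k) (largeLevel α k) (cellCount (τ + 1 - α) k) := by
  classical
  refine Finset.mem_filter.2 ⟨Finset.mem_range.2 hm, fun y hy => ?_⟩
  set D := τ + 1 - α with hD
  set q := cellCount D k with hq
  have hD0 : 0 < D := by linarith
  have hq0 : (0 : ℝ) < q := by exact_mod_cast cellCount_pos D k
  have hN0 : 0 < N := by
    have : 0 < 2 ^ k := by positivity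
    omega
  have hNr : (0 : ℝ) < N := by exact_mod_cast hN0
  have hNle : (N : ℝ) ≤ 2 ^ k := by exact_mod_cast hN'
  have hNge : (2 : ℝ) ^ k / 2 ≤ N := by
    have : (2 : ℝ) ^ k ≤ 2 * N := by exact_mod_cast hN
    linarith
  have hxy : |x - y| ≤ 1 / q := by
    have e : ((m : ℝ) + 1) / q = m / q + 1 / q := by ring
    rw [e] at hxm hy
    rw [abs_le]
    constructor <;> linarith [hxm.1, hxm.2, hy.1, hy.2]
  have hpi := Real.pi_pos
  have hNq : 4 * Real.pi * (N : ℝ) ^ D ≤ q := by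
    refine le_trans ?_ (le_cellCount D k)
    gcongr
  have hpow : (N : ℝ) * (N : ℝ) ^ τ = (N : ℝ) ^ D * (N : ℝ) ^ α := by
    rw [← Real.rpow_add hNr, hD]
    nth_rewrite 1 [← Real.rpow_one (N : ℝ)]
    rw [← Real.rpow_add hNr]; congr 1; ring
  have hα0 : 0 < (N : ℝ) ^ α := Real.rpow_pos_of_pos hNr _
  have hdiff : ‖seqSum (floorPow τ) (block 0 N) x - seqSum (floorPow τ) (block 0 N) y‖ ≤
      (N : ℝ) ^ α / 2 := by
    refine (norm_seqSum_floorPow_sub_le (by linarith) N x y).trans ?_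
    rw [hpow]
    calc 2 * Real.pi * |x - y| * ((N : ℝ) ^ D * (N : ℝ) ^ α)
        ≤ 2 * Real.pi * (1 / q) * ((N : ℝ) ^ D * (N : ℝ) ^ α) := by gcongr
      _ = (4 * Real.pi * (N : ℝ) ^ D) / q * ((N : ℝ) ^ α / 2) := by ring
      _ ≤ 1 * ((N : ℝ) ^ α / 2) := by
        gcongr
        rwa [div_le_one hq0]
      _ = _ := one_mul _
  have hy2 : (N : ℝ) ^ α / 2 ≤ ‖seqSum (floorPow τ) (block 0 N) y‖ := by
    have := norm_sub_norm_le (seqSum (floorPow τ) (block 0 N) x)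
      (seqSum (floorPow τ) (block 0 N) y)
    linarith
  have hmaj := hy2.trans (norm_seqSum_le_fourthMajorant (floorPow τ) k N hN' y)
  have hU1 := one_le_fourthMajorant (floorPow τ) k y
  have h1 : ((2 : ℝ) ^ k / 2) ^ α / (2 * ((k : ℝ) + 1) ^ 2) ≤
      fourthMajorant (floorPow τ) k y ^ (1 / 4 : ℝ) := by
    rw [div_le_iff₀ (by positivity)]
    have : ((2 : ℝ) ^ k / 2) ^ α ≤ (N : ℝ) ^ α :=
      Real.rpow_le_rpow (by positivity) hNge hα.le
    linarith
  have h2 := pow_le_pow_left₀ (by positivity) h1 4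
  unfold largeLevel
  refine h2.trans (le_of_eq ?_)
  rw [← Real.rpow_natCast, ← Real.rpow_mul (by linarith)]
  norm_num

/-- Every point of the large sum set lies in good cells of arbitrarily large index. -/
lemma exists_mem_goodCells {τ α : ℝ} (hτ : 1 ≤ τ) (hα : 0 < α) (hα1 : α < 1) {x : ℝ}
    (hx : x ∈ largeSumSet (piatetskiShapiro τ) α) (n : ℕ) :
    ∃ k, n ≤ k ∧ ∃ m ∈ goodCells (fourthMajorant (floorPow τ) k) (largeLevel α k)
      (cellCount (τ + 1 - α) k), x ∈ Icc ((m : ℝ) / cellCount (τ + 1 - α) k)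
        ((m + 1) / cellCount (τ + 1 - α) k) := by
  obtain ⟨⟨hx0, hx1⟩, hinf⟩ := hx
  obtain ⟨N, hN, hNn⟩ := hinf.exists_gt (2 ^ n)
  have hN1 : 1 < N := lt_of_le_of_lt (Nat.one_le_two_pow) hNn
  set k := Nat.clog 2 N with hk
  have hNk : N ≤ 2 ^ k := Nat.le_pow_clog (by norm_num) N
  have hkN : 2 ^ k ≤ 2 * N := by
    have h1 := Nat.pow_pred_clog_lt_self (b := 2) (by norm_num) hN1
    have h2 : 0 < k := Nat.clog_pos (by norm_num) hN1
    rw [← hk] at h1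
    obtain ⟨j, hj⟩ := Nat.exists_eq_succ_of_ne_zero h2.ne'
    rw [hj] at h1 ⊢
    rw [Nat.pred_succ] at h1
    rw [pow_succ]; omega
  have hnk : n ≤ k := by
    have : 2 ^ n < 2 ^ k := hNn.trans_le hNk
    exact ((Nat.pow_lt_pow_iff_right (by norm_num)).1 this).le
  rw [mem_ofPred_eq, expSum_piatetskiShapiro] at hN
  set q := cellCount (τ + 1 - α) k with hq
  have hqpos : 0 < q := cellCount_pos _ _
  have hq0 : (0 : ℝ) < q := by exact_mod_cast hqpos
  obtain ⟨m, hm, hxm⟩ : ∃ m, m < q ∧ x ∈ Icc ((m : ℝ) / q) ((m + 1) / q) := by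
    -- The endpoint `x = 1` goes to the last cell, since the floor would give the excluded index
    -- `q`.
    rcases hx1.eq_or_lt with rfl | hx1
    · refine ⟨q - 1, by omega, ?_, ?_⟩
      · rw [div_le_one hq0]
        exact_mod_cast Nat.sub_le _ _
      · rw [le_div_iff₀ hq0]
        have : q ≤ (q - 1) + 1 := by omega
        have : (q : ℝ) ≤ ((q - 1 : ℕ) : ℝ) + 1 := by exact_mod_cast this
        linarith
    · refine ⟨⌊x * q⌋₊, ?_, ?_, ?_⟩
      · rw [Nat.floor_lt (by positivity)]
        nlinarith
      · rw [div_le_iff₀ hq0]; exact Nat.floor_le (by positivity)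
      · rw [le_div_iff₀ hq0]; exact (Nat.lt_floor_add_one _).le
  exact ⟨k, hnk, m, mem_goodCells_of_large hτ hα hα1 hkN hNk hN hm hxm, hxm⟩

lemma summable_polynomial_mul_geometric (n : ℕ) {ρ : ℝ} (hρ0 : 0 < ρ) (hρ1 : ρ < 1) :
    Summable fun k : ℕ => ((k : ℝ) + 1) ^ n * ρ ^ k := by
  have h := summable_pow_mul_geometric_of_norm_lt_one (R := ℝ) n
    (r := ρ) (by rwa [Real.norm_eq_abs, abs_of_pos hρ0])
  have h1 := ((summable_nat_add_iff 1).2 h).mul_right ρ⁻¹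
  refine h1.congr fun k => ?_
  push_cast
  rw [pow_succ]
  field_simp

/-- The dimension bound in terms of an exponent `e` for the fourth moment. -/
theorem hausdorffMeasure_largeSumSet_eq_zero {τ α e s : ℝ} (hτ : 1 ≤ τ) (hα : 0 < α) (hα1 : α < 1)
    (he : 2 ≤ e) (heτ : 4 - τ ≤ e) (hs0 : 0 ≤ s) (hs1 : s ≤ 1)
    (hs : 1 - (4 * α - e) / (τ + 1 - α) < s) :
    Measure.hausdorffMeasure s (largeSumSet (piatetskiShapiro τ) α) = 0 := by
  set D := τ + 1 - α with hD
  have hD0 : 0 < D := by linarith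
  have hneg : D * (1 - s) + e - 4 * α < 0 := by
    have h1 : 1 - s < (4 * α - e) / D := by linarith
    rw [lt_div_iff₀ hD0] at h1
    linarith
  -- Half of the available slack is given to the energy bound, so the total exponent `δ` stays
  -- negative.
  set ε := -(D * (1 - s) + e - 4 * α) / 2 with hε
  have hε0 : 0 < ε := by linarith
  obtain ⟨C, hC, hint⟩ := exists_integral_fourthMajorant_le hτ he heτ hε0
  set δ := D * (1 - s) + (e + ε) - 4 * α with hδ
  have hδ0 : δ < 0 := by rw [hδ]; linarith
  set ρ : ℝ := 2 ^ δ with hρ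
  have hρ0 : 0 < ρ := by positivity
  have hρ1 : ρ < 1 := Real.rpow_lt_one_of_one_lt_of_neg (by norm_num) hδ0
  set q := cellCount D with hq
  set U := fourthMajorant (floorPow τ) with hU
  have hq0 : ∀ k, (0 : ℝ) < q k := fun k => by exact_mod_cast cellCount_pos D k
  let T : ℕ → Finset ℕ := fun k => goodCells (U k) (largeLevel α k) (q k)
  have hbound : ∀ k, ((T k).card : ℝ) * (1 / (q k : ℝ)) ^ s ≤
      (17 ^ (1 - s) * C * (16 * (2 ^ α) ^ 4)) * (((k : ℝ) + 1) ^ 10 * ρ ^ k) := by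
    intro k
    have hUcont : Continuous (U k) := continuous_fourthMajorant _ _
    have h1 := card_goodCells_le hUcont
      (fun x => zero_le_one.trans (one_le_fourthMajorant (floorPow τ) k x)) (largeLevel_pos α k)
      (cellCount_pos D k)
    set K : ℝ := 2 ^ k with hK
    have hK0 : 0 < K := by positivity
    have hlev : largeLevel α k = K ^ (4 * α) / ((16 * (2 ^ α) ^ 4) * ((k : ℝ) + 1) ^ 8) := by
      unfold largeLevel
      rw [Real.div_rpow hK0.le (by norm_num), mul_comm 4 α, Real.rpow_mul hK0.le]
      rw [show (4 : ℝ) = ((4 : ℕ) : ℝ) by norm_num, Real.rpow_natCast]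
      field_simp
      norm_num
    have hqs : (q k : ℝ) * (1 / (q k : ℝ)) ^ s ≤ 17 ^ (1 - s) * K ^ (D * (1 - s)) := by
      have e1 : (q k : ℝ) * (1 / (q k : ℝ)) ^ s = (q k : ℝ) ^ (1 - s) := by
        rw [one_div, Real.inv_rpow (hq0 k).le, Real.rpow_sub (hq0 k), Real.rpow_one]; rfl
      rw [e1, Real.rpow_mul hK0.le, ← Real.mul_rpow (by norm_num) (Real.rpow_nonneg hK0.le _)]
      exact Real.rpow_le_rpow (hq0 k).le (cellCount_le hD0.le k) (by linarith)
    -- The powers of `2 ^ k` combine to the exponent `δ`, leaving a polynomial in `k` times a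
    -- convergent geometric factor.
    have hpow : K ^ (D * (1 - s)) * K ^ (e + ε) / K ^ (4 * α) = ρ ^ k := by
      rw [← Real.rpow_add hK0, ← Real.rpow_sub hK0, hρ, hK, ← Real.rpow_natCast,
        ← Real.rpow_natCast, ← Real.rpow_mul (by norm_num), ← Real.rpow_mul (by norm_num), mul_comm]
    have hqs0 : 0 ≤ (1 / (q k : ℝ)) ^ s := by positivity
    calc ((T k).card : ℝ) * (1 / (q k : ℝ)) ^ s
        ≤ (q k * (∫ x in (0 : ℝ)..1, U k x) / largeLevel α k) * (1 / (q k : ℝ)) ^ s :=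
          mul_le_mul_of_nonneg_right h1 hqs0
      _ = (q k * (1 / (q k : ℝ)) ^ s) * (∫ x in (0 : ℝ)..1, U k x) / largeLevel α k := by ring
      _ ≤ (17 ^ (1 - s) * K ^ (D * (1 - s))) * (C * ((k : ℝ) + 1) ^ 2 * K ^ (e + ε)) /
          largeLevel α k := by
          refine div_le_div_of_nonneg_right ?_ (largeLevel_pos α k).le
          refine mul_le_mul hqs (hint k) ?_ (by positivity)
          exact intervalIntegral.integral_nonneg zero_le_one fun x _ =>
            zero_le_one.trans (one_le_fourthMajorant (floorPow τ) k x)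
      _ = (17 ^ (1 - s) * C * (16 * (2 ^ α) ^ 4)) * (((k : ℝ) + 1) ^ 10 *
          (K ^ (D * (1 - s)) * K ^ (e + ε) / K ^ (4 * α))) := by
          rw [hlev]; field_simp
      _ = _ := by rw [hpow]
  have hsummable : Summable fun k => ((T k).card : ℝ) * (1 / (q k : ℝ)) ^ s :=
    Summable.of_nonneg_of_le (fun k => by positivity) hbound
      ((summable_polynomial_mul_geometric 10 hρ0 hρ1).mul_left _)
  refine hausdorffMeasure_eq_zero_of_tsum_ne_top _ hs0 T
    (fun k m => Icc ((m : ℝ) / q k) ((m + 1) / q k)) (fun k => ENNReal.ofReal (1 / q k)) ?_ ?_ ?_ ?_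
    fun x hx n => exists_mem_goodCells hτ hα hα1 hx n
  · intro a b hab
    refine ENNReal.ofReal_le_ofReal (one_div_le_one_div_of_le (hq0 a) ?_)
    exact_mod_cast cellCount_mono hD0.le hab
  · rw [← ENNReal.ofReal_zero]
    refine ENNReal.tendsto_ofReal ?_
    have hgeom : Filter.Tendsto (fun k : ℕ => ((2 : ℝ) ^ (-D)) ^ k) Filter.atTop (nhds 0) :=
      tendsto_pow_atTop_nhds_zero_of_lt_one (by positivity)
        (Real.rpow_lt_one_of_one_lt_of_neg (by norm_num) (by linarith))
    refine squeeze_zero (fun k => by positivity) (fun k => ?_) hgeom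
    have h1 : ((2 : ℝ) ^ k) ^ D ≤ q k := by
      refine le_trans ?_ (le_cellCount D k)
      have := Real.pi_gt_three
      have h0 : 0 < ((2 : ℝ) ^ k) ^ D := by positivity
      nlinarith
    have e : ((2 : ℝ) ^ (-D)) ^ k = 1 / ((2 : ℝ) ^ k) ^ D := by
      rw [Real.rpow_neg (by norm_num), inv_pow, one_div, ← Real.rpow_natCast, ← Real.rpow_natCast,
        ← Real.rpow_mul (by norm_num), ← Real.rpow_mul (by norm_num), mul_comm]
    rw [e]
    exact one_div_le_one_div_of_le (by positivity) h1
  · intro k m _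
    rw [Real.ediam_Icc]
    refine ENNReal.ofReal_le_ofReal (le_of_eq ?_)
    ring
  · have hterm : ∀ k, ((T k).card : ENNReal) * ENNReal.ofReal (1 / q k) ^ s =
        ENNReal.ofReal (((T k).card : ℝ) * (1 / (q k : ℝ)) ^ s) := fun k => by
      rw [ENNReal.ofReal_mul (by positivity), ENNReal.ofReal_natCast,
        ENNReal.ofReal_rpow_of_nonneg (by positivity) hs0]
    simp_rw [hterm]
    exact hsummable.tsum_ofReal_ne_top

/-- If the inequality failed, some `s` would lie strictly between the bound and the dimension. Being
below a dimension at most 1 it satisfies `s ≤ 1`, as needed to estimate `q ^ (1 - s)`, and its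
Hausdorff measure vanishes, a contradiction. -/
theorem dimH_largeSumSet_le {τ α e : ℝ} (hτ : 1 ≤ τ) (hα : 0 < α) (hα1 : α < 1)
    (he : 2 ≤ e) (heτ : 4 - τ ≤ e) :
    dimH (largeSumSet (piatetskiShapiro τ) α) ≤
      ENNReal.ofReal (1 - (4 * α - e) / (τ + 1 - α)) := by
  by_contra! hcon
  obtain ⟨s, hs, hs'⟩ := ENNReal.lt_iff_exists_nnreal_btwn.1 hcon
  have hdim1 : dimH (largeSumSet (piatetskiShapiro τ) α) ≤ 1 :=
    (dimH_mono (subset_univ _)).trans Real.dimH_univ.le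
  have hs1 : s ≤ 1 := by exact_mod_cast (hs'.trans_le hdim1).le
  have hsb : 1 - (4 * α - e) / (τ + 1 - α) < s := by
    by_contra! h
    rw [← ENNReal.ofReal_coe_nnreal] at hs
    exact hs.not_ge (ENNReal.ofReal_le_ofReal h)
  have h := hausdorffMeasure_largeSumSet_eq_zero hτ hα hα1 he heτ s.2 (by exact_mod_cast hs1) hsb
  exact absurd (dimH_le_of_hausdorffMeasure_ne_top (h.trans_ne ENNReal.zero_ne_top))
    (not_le.2 hs')

theorem theorem3p4 (τ α : ℝ) (hτ : 1 ≤ τ) (hα : α ∈ Set.Ioo (1 / 2 : ℝ) 1) :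
    (τ < 2 → dimH (largeSumSet (piatetskiShapiro τ) α) ≤
        ENNReal.ofReal (1 - (4 * α + τ - 4) / (τ + 1 - α))) ∧
    (2 ≤ τ → dimH (largeSumSet (piatetskiShapiro τ) α) ≤
        ENNReal.ofReal (1 - (4 * α - 2) / (τ + 1 - α))) := by
  have hα0 : 0 < α := by linarith [hα.1]
  -- The energy exponent is `max 2 (4 - τ)`: it equals 2 for `τ ≥ 2` and `4 - τ` below.
  refine ⟨fun h => ?_, fun h => dimH_largeSumSet_le hτ hα0 hα.2 le_rfl (by linarith)⟩
  have := dimH_largeSumSet_le (e := 4 - τ) hτ hα0 hα.2 (by linarith) le_rfl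
  rwa [show 4 * α - (4 - τ) = 4 * α + τ - 4 by ring] at this
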